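/- **Theorem.** For an index $\mathbf k=(k_1,\dots,k_r)$ of positive integers let $$\bar T(k_1,\dots,k_r):=2^r\sum_{0<n_1<\cdots<n_r}\frac{(-1)^{n_r}}{(2n_1-1)^{k_1}(2n_2-2)^{k_2}\cdots(2n_r-r)^{k_r}},$$ where the series is summed in the order of increasing $n_r$, that is, its value is the limit as $N\to\infty$ of the finite sums over $0<n_1<\cdots<n_r\le N$. For positive integers $k\ge r$ let $$W(k,r):=\sum_{\substack{k_1+\cdots+k_r=k\\ k_1,\dots,k_r\ge 1}}\bar T(k_1,\dots,k_r).$$ Let $\bar\zeta(k):=\sum_{n\ge1}(-1)^{n-1}/n^k$ for $k\ge 1$, and for integers $1\le j\le p$ let $Z(p,p):=1$ and, if $j<p$, $$Z(j,p):=\sum_{k=1}^{p-j}(-2)^k\sum_{j=i_0<i_1<\cdots<i_k=p}\ \prod_{l=1}^k\bar\zeta(2i_l-2i_{l-1}).$$ For integers $n\ge1$ and $q\ge 0$ let $$T_n(\{1\}_{2q}):=\sum_{0<n_1\le n_2<n_3\le n_4<\cdots<n_{2q-1}\le n_{2q}<n}\ \prod_{i=1}^{q}\frac{4}{(2n_{2i-1}-1)(2n_{2i})},$$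 so that $T_n(\{1\}_0)=1$ and $T_n(\{1\}_{2q})=0$ for $q\ge 1$ and $n\le q$. Then for all positive integers $m,p$, all the values $\bar T(\mathbf k)$ occurring below and the series $\bar\zeta(2i)$, $i\ge1$, converge, the series on the left-hand side converges, and $$2\sum_{n=1}^{\infty}\frac{T_n(\{1\}_{2m-2})\,T_n(\{1\}_{2p-2})}{2n-1}(-1)^n=(-1)^{m-1}\sum_{j=1}^{p}W(2j+2m-3,\,2m-1)\,Z(j,p).$$ -/

import Mathlib

open Filter Topology

noncomputable section

namespace AltMTV

/-- The set `I(k, r)` of all `(k₁, …, k_r)` of positive integers with `k₁ + ⋯ + k_r = k`. -/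
def indexSet (k r : ℕ) : Finset (Fin r → ℕ) :=
  (Fintype.piFinset fun _ : Fin r => Finset.Icc 1 k).filter fun a => ∑ i, a i = k

/-- The tuples `(n₁, …, n_r)` of integers with `0 < n₁ < ⋯ < n_r ≤ N`. -/
def increasingTuples (r N : ℕ) : Finset (Fin r → ℕ) :=
  (Fintype.piFinset fun _ : Fin r => Finset.Icc 1 N).filter fun a => StrictMono a

/-- The last entry `n_r` of `(n₁, …, n_r)` (with the convention `n₀ = 0` for the empty tuple). -/
def lastEntry {r : ℕ} (a : Fin r → ℕ) : ℕ :=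
  (Fin.cons 0 a : Fin (r + 1) → ℕ) (Fin.last r)

/-- The part `n_r ≤ N` of the series defining `T̄(k₁, …, k_r)`:
`2 ^ r ∑_{0 < n₁ < ⋯ < n_r ≤ N} (-1) ^ n_r / ((2 n₁ - 1) ^ k₁ (2 n₂ - 2) ^ k₂ ⋯ (2 n_r - r) ^ k_r)`.
The position `i : Fin r` stands for the 1-based position `i + 1`. -/
def tbarTrunc {r : ℕ} (k : Fin r → ℕ) (N : ℕ) : ℝ :=
  2 ^ r * ∑ a ∈ increasingTuples r N,
    (-1 : ℝ) ^ lastEntry a / ∏ i : Fin r, (2 * (a i : ℝ) - ((i : ℕ) + 1)) ^ k i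

/-- The alternating multiple `T`-value `T̄(k₁, …, k_r)`. The series need not converge absolutely
(when `k_r = 1`); it is summed by increasing size of the outermost variable `n_r`. -/
def tbar {r : ℕ} (k : Fin r → ℕ) : ℝ :=
  limUnder atTop (tbarTrunc k)

/-- The sum `W(k, r)` of all `T̄(k₁, …, k_r)` of weight `k` and depth `r`. -/
def W (k r : ℕ) : ℝ :=
  ∑ a ∈ indexSet k r, tbar a

/-- Partial sums of `∑_{n ≥ 1} (-1) ^ (n - 1) / n ^ k`. -/
def zetaBarTrunc (k N : ℕ) : ℝ :=
  ∑ n ∈ Finset.Icc 1 N, (-1 : ℝ) ^ (n - 1) / (n : ℝ) ^ k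

/-- The alternating zeta value `ζ̄(k)`, with `ζ̄(0) = 1 / 2`. -/
def zetaBar (k : ℕ) : ℝ :=
  if k = 0 then 1 / 2 else limUnder atTop (zetaBarTrunc k)

/-- The chains `j = i₀ < i₁ < ⋯ < i_k = p`. -/
def chains (j p k : ℕ) : Finset (Fin (k + 1) → ℕ) :=
  (Fintype.piFinset fun _ : Fin (k + 1) => Finset.Icc j p).filter fun i =>
    StrictMono i ∧ i 0 = j ∧ i (Fin.last k) = p

/-- `Z(p, p) = 1`, and for `j < p`
`Z(j, p) = ∑_{k = 1}^{p - j} (-2) ^ k ∑_{j = i₀ < ⋯ < i_k = p} ∏_{l = 1}^k ζ̄(2 i_l - 2 i_{l-1})`. -/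
def Z (j p : ℕ) : ℝ :=
  if j = p then 1 else
    ∑ k ∈ Finset.Icc 1 (p - j), (-2 : ℝ) ^ k *
      ∑ i ∈ chains j p k, ∏ l : Fin k, zetaBar (2 * i l.succ - 2 * i l.castSucc)

/-- The tuples `(n₁, …, n_r)` with `0 < n₁ ≤ n₂ < n₃ ≤ n₄ < ⋯`, where the pattern of `≤` (after an
odd position) and `<` (after an even position) continues up to the comparison of `n_r` with `n`:
`n_r ≤ n` for odd `r`, and `n_r < n` for even `r > 0`. (The 1-based odd positions are the
0-based even ones.) -/
def tTuples (r n : ℕ) : Finset (Fin r → ℕ) :=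
  (Fintype.piFinset fun _ : Fin r => Finset.Icc 1 n).filter fun a =>
    ∀ i : Fin r,
      if Even (i : ℕ) then
        (Fin.snoc a n : Fin (r + 1) → ℕ) i.castSucc ≤ (Fin.snoc a n : Fin (r + 1) → ℕ) i.succ
      else
        (Fin.snoc a n : Fin (r + 1) → ℕ) i.castSucc < (Fin.snoc a n : Fin (r + 1) → ℕ) i.succ

/-- The multiple `T`-harmonic sum `T_n(k₁, …, k_r)`: the variable `n_i` contributes
`(2 n_i - 1) ^ k_i` for odd `i` and `(2 n_i) ^ k_i` for even `i` to the denominator.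
For `r = 0` it is `1`. -/
def tHarm {r : ℕ} (k : Fin r → ℕ) (n : ℕ) : ℝ :=
  ∑ a ∈ tTuples r n, 2 ^ r /
    ∏ i : Fin r, (if Even (i : ℕ) then 2 * (a i : ℝ) - 1 else 2 * (a i : ℝ)) ^ k i

/-- The index `{1}_r = (1, …, 1)` of depth `r`. -/
def ones (r : ℕ) : Fin r → ℕ := fun _ => 1

end AltMTV

end

/-!
Put `L t = log ((1 + t) / (1 - t))`. Integrating by parts, the moments
`M k d = ∫₀¹ t ^ k L ^ d / d!` satisfy `(k + 2) M (k + 1) (d + 1) = k M (k - 1) (d + 1) + 2 M k d`.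
Hence `(2 n + 1) M (2 n) (2 b)` is the convolution of the sums `T_{n + 1}({1}_{2 i})` with the
values `M 0 (2 i) = 2 ζ̄(2 i)`, and convolution with `Z` inverts this. It remains to sum
`∑ (-1) ^ n T_{n + 1}({1}_{2 a}) M (2 n) (2 b)`. Since `∑ (-1) ^ n T_{n + 1}({1}_{2 a}) t ^ (2 n)`
is `(-1) ^ a / 2` times the derivative of `(2 arctan t) ^ (2 a + 1) / (2 a + 1)!`, Abel summation
turns the sum into the integral of this derivative against `L ^ (2 b) / (2 b)!`, up to the factor
`(-1) ^ a / 2`. The substitution `s = (1 - t) / (1 + t)` turns `2 dt / (1 - t ^ 2)` into `-ds / s`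
and preserves `2 dt / (1 + t ^ 2)` up to sign, so the integral is an iterated integral of these two
forms: the value at `s = 1` of a multiple polylogarithm, which is `W (2 a + 1 + 2 b, 2 a + 1)` up to
sign.
-/

noncomputable section

namespace AltMTV

open Asymptotics MeasureTheory
open scoped Nat

/-! ### Sequences of logarithmic growth -/

/-- Symbols of order `s`, as in the theory of pseudodifferential operators but for sequences: up to
an arbitrarily small power of `n` (which absorbs logarithms), `u` grows at most like `n ^ s` and its
increments at most like `n ^ (s - 1)`. -/
def IsSymbol (s : ℝ) (u : ℕ → ℝ) : Prop :=
  ∀ ε > 0, (u =O[atTop] fun n : ℕ => ((n : ℝ) + 1) ^ (s + ε)) ∧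
    (fun n => u (n + 1) - u n) =O[atTop] fun n : ℕ => ((n : ℝ) + 1) ^ (s - 1 + ε)

lemma isBigO_succ_rpow {s t : ℝ} (h : s ≤ t) :
    (fun n : ℕ => ((n : ℝ) + 1) ^ s) =O[atTop] fun n : ℕ => ((n : ℝ) + 1) ^ t :=
  .of_norm_le fun n => by
    rw [Real.norm_of_nonneg (by positivity)]
    exact Real.rpow_le_rpow_of_exponent_le (by linarith [n.cast_nonneg (α := ℝ)]) h

lemma succ_rpow_mul (s t : ℝ) (n : ℕ) :
    ((n : ℝ) + 1) ^ s * ((n : ℝ) + 1) ^ t = ((n : ℝ) + 1) ^ (s + t) :=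
  (Real.rpow_add (by positivity) s t).symm

/-- Compares the sum with the telescoping sum of `(i + 1) ^ ε - i ^ ε`. -/
lemma sum_succ_rpow_le {ε : ℝ} (hε : 0 < ε) (hε' : ε ≤ 1) (N : ℕ) :
    ∑ i ∈ Finset.range N, ((i : ℝ) + 1) ^ (ε - 1) ≤ (N : ℝ) ^ ε / ε := by
  rw [le_div_iff₀' hε, Finset.mul_sum, ← sub_zero ((N : ℝ) ^ ε), ← Real.zero_rpow hε.ne']
  rw [← Nat.cast_zero, ← Finset.sum_range_sub fun i : ℕ => (i : ℝ) ^ ε]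
  refine Finset.sum_le_sum fun i _ => ?_
  have hi : (0 : ℝ) < i + 1 := by positivity
  have bernoulli : (1 + -1 / ((i : ℝ) + 1)) ^ ε ≤ 1 + ε * (-1 / ((i : ℝ) + 1)) := by
    refine rpow_one_add_le_one_add_mul_self ?_ hε.le hε'
    rw [le_div_iff₀ hi]; linarith
  have hmul := mul_le_mul_of_nonneg_right bernoulli (Real.rpow_nonneg hi.le ε)
  rw [← Real.mul_rpow (by rw [one_add_div hi.ne', add_neg_cancel_right]; positivity) hi.le,
    one_add_div hi.ne', div_mul_cancel₀ _ hi.ne', add_neg_cancel_right] at hmul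
  rw [Real.rpow_sub_one hi.ne', Nat.cast_succ]
  calc ε * (((i : ℝ) + 1) ^ ε / (i + 1))
      = (i + 1) ^ ε - (1 + ε * (-1 / (i + 1))) * (i + 1) ^ ε := by ring
    _ ≤ _ := by linarith

namespace IsSymbol

variable {s t : ℝ} {u v : ℕ → ℝ}

lemma of_isBigO (hu : u =O[atTop] fun n : ℕ => ((n : ℝ) + 1) ^ s)
    (hΔ : (fun n => u (n + 1) - u n) =O[atTop] fun n : ℕ => ((n : ℝ) + 1) ^ (s - 1)) :
    IsSymbol s u := fun _ hε =>
  ⟨hu.trans (isBigO_succ_rpow (by linarith)), hΔ.trans (isBigO_succ_rpow (by linarith))⟩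

lemma mono (hu : IsSymbol s u) (h : s ≤ t) : IsSymbol t u := fun ε hε =>
  ⟨(hu ε hε).1.trans (isBigO_succ_rpow (by linarith)),
    (hu ε hε).2.trans (isBigO_succ_rpow (by linarith))⟩

lemma const (c : ℝ) : IsSymbol 0 fun _ => c :=
  of_isBigO (by simpa using isBigO_const_one ℝ c atTop) (by simpa using isBigO_zero _ _)

lemma add (hu : IsSymbol s u) (hv : IsSymbol s v) : IsSymbol s fun n => u n + v n :=
  fun ε hε => ⟨(hu ε hε).1.add (hv ε hε).1,
    ((hu ε hε).2.add (hv ε hε).2).congr_left fun n => by ring⟩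

lemma sum {ι : Type*} (A : Finset ι) {w : ι → ℕ → ℝ} (hw : ∀ i ∈ A, IsSymbol s (w i)) :
    IsSymbol s fun n => ∑ i ∈ A, w i n := fun ε hε =>
  ⟨.fun_sum fun i hi => (hw i hi ε hε).1, by
    simpa only [Finset.sum_sub_distrib] using
      IsBigO.fun_sum (A := fun i n => w i (n + 1) - w i n) fun i hi => (hw i hi ε hε).2⟩

lemma isBigO_shift (hu : IsSymbol s u) {ε : ℝ} (hε : 0 < ε) :
    (fun n => u (n + 1)) =O[atTop] fun n : ℕ => ((n : ℝ) + 1) ^ (s + ε) :=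
  ((hu ε hε).1.add ((hu ε hε).2.trans (isBigO_succ_rpow (by linarith)))).congr_left
    fun n => by ring

lemma mul (hu : IsSymbol s u) (hv : IsSymbol t v) : IsSymbol (s + t) fun n => u n * v n := by
  intro ε hε
  have hε' := half_pos hε
  refine ⟨((hu _ hε').1.mul (hv _ hε').1).congr_right fun n => ?_, ?_⟩
  · rw [succ_rpow_mul]; ring_nf
  · have h₁ := ((hu.isBigO_shift hε').mul (hv _ hε').2).congr_right fun n =>
      succ_rpow_mul _ _ n
    have h₂ := ((hu _ hε').2.mul (hv _ hε').1).congr_right fun n => succ_rpow_mul _ _ n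
    rw [show s + ε / 2 + (t - 1 + ε / 2) = s + t - 1 + ε by ring] at h₁
    rw [show s - 1 + ε / 2 + (t + ε / 2) = s + t - 1 + ε by ring] at h₂
    exact (h₁.add h₂).congr_left fun n => by ring

lemma const_mul (c : ℝ) (hu : IsSymbol s u) : IsSymbol s fun n => c * u n := by
  simpa only [zero_add] using (const c).mul hu

lemma pow (hu : IsSymbol s u) (k : ℕ) : IsSymbol (k * s) fun n => u n ^ k := by
  induction k with
  | zero => simpa using const 1
  | succ k ih => simpa only [pow_succ, Nat.cast_succ, add_one_mul] using ih.mul hu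

lemma inv_linear {a c : ℝ} (ha : 0 < a) (hc : 0 < c) : IsSymbol (-1) fun n => (a * n + c)⁻¹ := by
  have hO : (fun n : ℕ => (a * n + c)⁻¹) =O[atTop] fun n : ℕ => ((n : ℝ) + 1) ^ (-1 : ℝ) := by
    refine .of_bound (1 / a + 1 / c) (.of_forall fun n => ?_)
    rw [Real.rpow_neg_one, norm_inv, norm_inv, Real.norm_of_nonneg (by positivity),
      Real.norm_of_nonneg (by positivity), ← div_eq_mul_inv, inv_eq_one_div,
      div_le_div_iff₀ (by positivity) (by positivity)]
    have : (1 / a + 1 / c) * (a * n + c) = n + 1 + (c / a + a / c * n) := by field_simp; ring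
    linarith [show 0 ≤ c / a + a / c * n by positivity]
  have hO' : (fun n : ℕ => (a * ((n + 1 : ℕ) : ℝ) + c)⁻¹) =O[atTop]
      fun n : ℕ => ((n : ℝ) + 1) ^ (-1 : ℝ) := by
    refine .trans (.of_norm_le fun n => ?_) hO
    rw [Real.norm_of_nonneg (by positivity), Nat.cast_succ]
    gcongr
    linarith
  refine of_isBigO hO (((hO.mul hO').const_mul_left (-a)).congr (fun n => ?_) fun n => ?_)
  · push_cast; field_simp; ring
  · rw [succ_rpow_mul]; norm_num

lemma exists_forall_le (hu : IsSymbol s u) {ε : ℝ} (hε : 0 < ε) :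
    ∃ C > 0, ∀ n : ℕ, |u n| ≤ C * ((n : ℝ) + 1) ^ (s + ε) := by
  obtain ⟨C, hC, hle⟩ := bound_of_isBigO_nat_atTop (hu ε hε).1
  refine ⟨C, hC, fun n => ?_⟩
  have hpos : (0 : ℝ) < ((n : ℝ) + 1) ^ (s + ε) := by positivity
  simpa only [Real.norm_eq_abs, abs_of_pos hpos] using hle hpos.ne'

lemma sum_range (hu : IsSymbol (-1) u) : IsSymbol 0 fun N => ∑ i ∈ Finset.range N, u i := by
  intro ε hε
  refine ⟨?_, by simpa only [Finset.sum_range_succ_sub_sum, zero_sub] using (hu ε hε).1⟩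
  obtain ⟨δ, hδ, hδε, hδ1⟩ : ∃ δ > 0, δ ≤ ε ∧ δ ≤ 1 :=
    ⟨min ε 1, lt_min hε one_pos, min_le_left .., min_le_right ..⟩
  obtain ⟨C, hC, hle⟩ := hu.exists_forall_le hδ
  refine IsBigO.trans (.of_bound (C / δ) (.of_forall fun N => ?_))
    (isBigO_succ_rpow (s := δ) (by linarith))
  rw [Real.norm_of_nonneg (r := _ ^ δ) (by positivity)]
  calc ‖∑ i ∈ Finset.range N, u i‖
      ≤ ∑ i ∈ Finset.range N, C * ((i : ℝ) + 1) ^ (δ - 1) := by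
        refine norm_sum_le_of_le _ fun i _ => ?_
        simpa only [Real.norm_eq_abs, neg_add_eq_sub] using hle i
    _ ≤ C * ((N : ℝ) ^ δ / δ) := by
        rw [← Finset.mul_sum]
        exact mul_le_mul_of_nonneg_left (sum_succ_rpow_le hδ hδ1 N) hC.le
    _ ≤ C / δ * ((N : ℝ) + 1) ^ δ := by
        rw [mul_div_assoc', div_mul_eq_mul_div]
        gcongr
        linarith

end IsSymbol

lemma sum_neg_one_pow_mul (v : ℕ → ℝ) (N : ℕ) :
    ∑ n ∈ Finset.range N, (-1 : ℝ) ^ n * v n = (v 0 - (-1) ^ N * v N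
      - ∑ n ∈ Finset.range N, (-1 : ℝ) ^ n * (v (n + 1) - v n)) / 2 := by
  induction N with
  | zero => simp
  | succ N ih => rw [Finset.sum_range_succ, ih, Finset.sum_range_succ, pow_succ]; ring

lemma IsSymbol.exists_tendsto_alternating {s : ℝ} {u : ℕ → ℝ} (hs : s < 0) (hu : IsSymbol s u) :
    ∃ L : ℝ, Tendsto (fun N => ∑ n ∈ Finset.range N, (-1 : ℝ) ^ n * u n) atTop (𝓝 L) := by
  have hε : 0 < -s / 2 := by linarith
  have hsucc : Tendsto (fun n : ℕ => (n : ℝ) + 1) atTop atTop :=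
    tendsto_atTop_add_const_right _ _ tendsto_natCast_atTop_atTop
  have hzero : Tendsto u atTop (𝓝 0) := by
    refine (hu _ hε).1.trans_tendsto ?_
    rw [show s + -s / 2 = -(-s / 2) by ring]
    exact (tendsto_rpow_neg_atTop hε).comp hsucc
  have hboundary : Tendsto (fun N => (-1 : ℝ) ^ N * u N) atTop (𝓝 0) :=
    squeeze_zero_norm (fun N => by simp) (tendsto_zero_iff_norm_tendsto_zero.1 hzero)
  have hsum : Summable fun n => (-1 : ℝ) ^ n * (u (n + 1) - u n) := by
    have hgauge : Summable fun n : ℕ => ((n : ℝ) + 1) ^ (s - 1 + -s / 2) := by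
      simpa using (summable_nat_add_iff 1).2
        (Real.summable_nat_rpow (p := s - 1 + -s / 2) |>.2 (by linarith))
    refine summable_of_isBigO_nat hgauge
      (IsBigO.trans (.of_norm_le fun n => ?_) (hu _ hε).2.norm_left)
    simp
  exact ⟨_, (((tendsto_const_nhds.sub hboundary).sub hsum.hasSum.tendsto_sum_nat).div_const
    2).congr fun N => (sum_neg_one_pow_mul u N).symm⟩

/-! ### Sums over chains of fixed parity -/

/-- The contribution to `2 ^ r ∑ ∏ mᵢ ^ (-kᵢ)`, taken over all `kᵢ ≥ 1` with `∑ kᵢ = r + d`, of the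
chains `0 < m₁ < ⋯ < m_r = r + 2 i` with `mᵢ ≡ i` modulo `2`. The substitution `mᵢ = 2 nᵢ - i` turns
these into the terms of the values `T̄(k₁, …, k_r)` with `n_r = r + i`. -/
def chainCoeff : ℕ → ℕ → ℕ → ℝ
  | 0, d, i => if d = 0 ∧ i = 0 then 1 else 0
  | r + 1, d, i => ∑ e ∈ Finset.range (d + 1),
      2 * (∑ l ∈ Finset.range (i + 1), chainCoeff r (d - e) l) / ((r : ℝ) + 1 + 2 * i) ^ (e + 1)

/-- The partial sums of `chainCoeff`: the chains with `m_r ≤ r + 2 j`. -/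
def chainSum (r d j : ℕ) : ℝ := ∑ i ∈ Finset.range (j + 1), chainCoeff r d i

lemma chainCoeff_zero (d i : ℕ) : chainCoeff 0 d i = if d = 0 ∧ i = 0 then 1 else 0 := by
  rw [chainCoeff]

lemma chainCoeff_succ (r d i : ℕ) :
    chainCoeff (r + 1) d i = ∑ e ∈ Finset.range (d + 1),
      2 * chainSum r (d - e) i / ((r : ℝ) + 1 + 2 * i) ^ (e + 1) := by
  simp only [chainCoeff, chainSum]

lemma chainCoeff_succ_zero (r i : ℕ) :
    chainCoeff (r + 1) 0 i = 2 * chainSum r 0 i / ((r : ℝ) + 1 + 2 * i) := by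
  simp [chainCoeff_succ]

lemma chainCoeff_succ_succ (r d i : ℕ) :
    chainCoeff (r + 1) (d + 1) i
      = (2 * chainSum r (d + 1) i + chainCoeff (r + 1) d i) / ((r : ℝ) + 1 + 2 * i) := by
  rw [chainCoeff_succ, Finset.sum_range_succ', chainCoeff_succ r d, add_comm, add_div,
    Finset.sum_div]
  simp only [Nat.add_sub_add_right, Nat.sub_zero, zero_add, pow_zero, pow_succ, one_mul, div_div]

lemma chainSum_zero (d j : ℕ) : chainSum 0 d j = if d = 0 then 1 else 0 := by
  simp only [chainSum, chainCoeff_zero, ite_and]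
  simp

lemma IsSymbol.of_eventually_eq_zero {u : ℕ → ℝ} (s : ℝ) (h : u =ᶠ[atTop] 0) : IsSymbol s u :=
  of_isBigO (h.trans_isBigO (isBigO_zero _ _))
    (((h.comp_tendsto (tendsto_add_atTop_nat 1)).sub h).trans_isBigO <|
      (isBigO_zero _ _).congr_left fun _ => (sub_zero 0).symm)

lemma IsSymbol.sum_range_succ {u : ℕ → ℝ} (hu : IsSymbol (-1) u) :
    IsSymbol 0 fun N => ∑ i ∈ Finset.range (N + 1), u i := by
  simpa only [Finset.sum_range_succ] using hu.sum_range.add (hu.mono (by norm_num))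

lemma IsSymbol.inv_linear_pow {a c : ℝ} (ha : 0 < a) (hc : 0 < c) {k : ℕ} (hk : 1 ≤ k) :
    IsSymbol (-1) fun n => ((a * n + c) ^ k)⁻¹ := by
  simpa only [inv_pow] using ((inv_linear ha hc).pow k).mono <| by
    linarith [show (1 : ℝ) ≤ k from mod_cast hk]

lemma IsSymbol.div_shifted_pow {u : ℕ → ℝ} (hu : IsSymbol 0 u) (r : ℕ) {k : ℕ} (hk : 1 ≤ k) :
    IsSymbol (-1) fun i => u i / ((r : ℝ) + 1 + 2 * i) ^ k := by
  simpa only [add_comm _ ((r : ℝ) + 1), zero_add, ← div_eq_mul_inv] using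
    hu.mul (inv_linear_pow (a := 2) (c := (r : ℝ) + 1) (by norm_num) (by positivity) hk)

lemma isSymbol_chainCoeff (r d : ℕ) : IsSymbol (-1) (chainCoeff r d) := by
  induction r generalizing d with
  | zero =>
    refine .of_eventually_eq_zero _ ((eventually_ge_atTop 1).mono fun i hi => ?_)
    rw [chainCoeff_zero, if_neg (by omega), Pi.zero_apply]
  | succ r ih =>
    simp only [funext (chainCoeff_succ r d)]
    exact .sum _ fun e _ => ((ih (d - e)).sum_range_succ.const_mul 2).div_shifted_pow r (by omega)

lemma isSymbol_chainSum (r d : ℕ) : IsSymbol 0 (chainSum r d) :=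
  (isSymbol_chainCoeff r d).sum_range_succ

/-! ### Sums over increasing tuples -/

lemma sum_eq_sum_snoc {α M : Type*} [AddCommMonoid M] {r : ℕ} {S : Finset (Fin (r + 1) → α)}
    {A : Finset α} {B : α → Finset (Fin r → α)}
    (h : ∀ b n, (Fin.snoc b n : Fin (r + 1) → α) ∈ S ↔ n ∈ A ∧ b ∈ B n)
    (f : (Fin (r + 1) → α) → M) :
    ∑ a ∈ S, f a = ∑ n ∈ A, ∑ b ∈ B n, f (Fin.snoc b n) := by
  rw [Finset.sum_sigma']
  refine Finset.sum_nbij' (fun a => ⟨a (Fin.last r), Fin.init a⟩) (fun x => Fin.snoc x.2 x.1)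
    (fun a ha => ?_) (fun x hx => (h _ _).2 (Finset.mem_sigma.1 hx))
    (fun a _ => Fin.snoc_init_self a) (fun x _ => by simp) fun a _ => by rw [Fin.snoc_init_self]
  rwa [Finset.mem_sigma, ← h, Fin.snoc_init_self]

lemma forall_snoc_iff {α : Type*} {r : ℕ} {b : Fin r → α} {n : α} {P : α → Prop} :
    (∀ i, P ((Fin.snoc b n : Fin (r + 1) → α) i)) ↔ (∀ i, P (b i)) ∧ P n := by
  rw [Fin.forall_fin_succ']
  simp

lemma strictMono_snoc_iff {α : Type*} [Preorder α] {r : ℕ} {b : Fin r → α} {n : α} :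
    StrictMono (Fin.snoc b n : Fin (r + 1) → α) ↔ StrictMono b ∧ ∀ i, b i < n := by
  rw [← Fin.insertNth_last', Fin.strictMono_insertNth_iff]
  simp [Fin.castSucc_lt_last, Fin.last_le_iff, Fin.castSucc_ne_last]

lemma mem_increasingTuples {r N : ℕ} {a : Fin r → ℕ} :
    a ∈ increasingTuples r N ↔ (∀ i, 1 ≤ a i ∧ a i ≤ N) ∧ StrictMono a := by
  simp [increasingTuples]

lemma increasingTuples_zero (N : ℕ) : increasingTuples 0 N = {Fin.elim0} := by
  ext a
  simp [mem_increasingTuples, Subsingleton.elim a Fin.elim0, StrictMono]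

lemma snoc_mem_increasingTuples {r N n : ℕ} {b : Fin r → ℕ} :
    (Fin.snoc b n : Fin (r + 1) → ℕ) ∈ increasingTuples (r + 1) N ↔
      n ∈ Finset.Icc 1 N ∧ b ∈ increasingTuples r (n - 1) := by
  simp only [mem_increasingTuples, strictMono_snoc_iff, Finset.mem_Icc,
    forall_snoc_iff (P := fun x => 1 ≤ x ∧ x ≤ N)]
  constructor
  · rintro ⟨⟨hb, hn⟩, hmono, hlt⟩
    exact ⟨hn, fun i => ⟨(hb i).1, Nat.le_pred_of_lt (hlt i)⟩, hmono⟩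
  · rintro ⟨hn, hb, hmono⟩
    have hlt : ∀ i, b i < n := fun i => by have := hb i; omega
    exact ⟨⟨fun i => ⟨(hb i).1, (hlt i).le.trans hn.2⟩, hn⟩, hmono, hlt⟩

/-- The finite sums `2 ^ r ∑_{0 < n₁ < ⋯ < n_r ≤ N} ∏ (2 nᵢ - i) ^ (-kᵢ)`, the non-alternating
analogue of `tbarTrunc`. -/
def tuplesSum {r : ℕ} (k : Fin r → ℕ) (N : ℕ) : ℝ :=
  ∑ a ∈ increasingTuples r N, ∏ i : Fin r, 2 / (2 * (a i : ℝ) - ((i : ℕ) + 1)) ^ k i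

lemma tuplesSum_zero (k : Fin 0 → ℕ) (N : ℕ) : tuplesSum k N = 1 := by
  simp [tuplesSum, increasingTuples_zero]

lemma tuplesSum_snoc {r : ℕ} (k : Fin r → ℕ) (l N : ℕ) :
    tuplesSum (Fin.snoc k l : Fin (r + 1) → ℕ) N
      = ∑ n ∈ Finset.Icc 1 N, 2 * tuplesSum k (n - 1) / (2 * (n : ℝ) - (r + 1)) ^ l := by
  rw [tuplesSum, sum_eq_sum_snoc fun _ _ => snoc_mem_increasingTuples]
  refine Finset.sum_congr rfl fun n _ => ?_
  rw [tuplesSum, Finset.mul_sum, Finset.sum_div]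
  refine Finset.sum_congr rfl fun b _ => ?_
  simp only [Fin.prod_univ_castSucc, Fin.snoc_castSucc, Fin.snoc_last, Fin.val_castSucc,
    Fin.val_last]
  ring

lemma tbarTrunc_snoc {r : ℕ} (k : Fin r → ℕ) (l N : ℕ) :
    tbarTrunc (Fin.snoc k l : Fin (r + 1) → ℕ) N = ∑ n ∈ Finset.Icc 1 N,
      (-1 : ℝ) ^ n * (2 * tuplesSum k (n - 1) / (2 * (n : ℝ) - (r + 1)) ^ l) := by
  rw [tbarTrunc, sum_eq_sum_snoc fun _ _ => snoc_mem_increasingTuples, Finset.mul_sum]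
  refine Finset.sum_congr rfl fun n _ => ?_
  rw [tuplesSum, Finset.mul_sum, Finset.mul_sum, Finset.sum_div, Finset.mul_sum]
  refine Finset.sum_congr rfl fun b _ => ?_
  have hlast : lastEntry (Fin.snoc b n : Fin (r + 1) → ℕ) = n := by
    rw [lastEntry, ← Fin.succ_last, Fin.cons_succ, Fin.snoc_last]
  simp only [hlast, Fin.prod_univ_castSucc, Fin.snoc_castSucc, Fin.snoc_last, Fin.val_castSucc,
    Fin.val_last, Finset.prod_div_distrib, Finset.prod_const, Finset.card_univ, Fintype.card_fin]
  ring

lemma tuplesSum_eq_zero {r : ℕ} (k : Fin r → ℕ) {N : ℕ} (h : N < r) : tuplesSum k N = 0 := by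
  refine Finset.sum_eq_zero fun a ha => absurd ?_ h.not_ge
  rw [mem_increasingTuples] at ha
  simpa using Finset.card_le_card_of_injOn (s := .univ) (t := .Icc 1 N) a
    (fun i _ => Finset.mem_coe.2 (Finset.mem_Icc.2 (ha.1 i))) ha.2.injective.injOn

lemma sum_Icc_eq_sum_range {M : Type*} [AddCommMonoid M] (f : ℕ → M) (N : ℕ) :
    ∑ n ∈ Finset.Icc 1 N, f n = ∑ n ∈ Finset.range N, f (n + 1) := by
  rw [Finset.range_eq_Ico, Finset.sum_Ico_add' f 0 N 1]
  rfl

lemma sum_Icc_shift {M : Type*} [AddCommMonoid M] {f : ℕ → M} {r : ℕ} (j : ℕ)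
    (hf : ∀ n, 1 ≤ n → n ≤ r → f n = 0) :
    ∑ n ∈ Finset.Icc 1 (r + j), f n = ∑ i ∈ Finset.range j, f (r + i + 1) := by
  rw [sum_Icc_eq_sum_range, Finset.sum_range_add, Finset.sum_eq_zero, zero_add]
  exact fun n hn => hf _ (by omega) (by simpa using hn)

lemma tuplesSum_snoc_shift {r : ℕ} (k : Fin r → ℕ) (l j : ℕ) :
    tuplesSum (Fin.snoc k l : Fin (r + 1) → ℕ) (r + 1 + j)
      = ∑ i ∈ Finset.range (j + 1), 2 * tuplesSum k (r + i) / ((r : ℝ) + 1 + 2 * i) ^ l := by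
  rw [tuplesSum_snoc, add_assoc, add_comm 1 j, sum_Icc_shift]
  · refine Finset.sum_congr rfl fun i _ => ?_
    rw [Nat.add_sub_cancel]
    congr 2
    push_cast; ring
  · intro n _ hn
    rw [tuplesSum_eq_zero k (by omega), mul_zero, zero_div]

lemma tbarTrunc_snoc_shift {r : ℕ} (k : Fin r → ℕ) (l j : ℕ) :
    tbarTrunc (Fin.snoc k l : Fin (r + 1) → ℕ) (r + j) = (-1) ^ (r + 1) *
      ∑ i ∈ Finset.range j,
        (-1 : ℝ) ^ i * (2 * tuplesSum k (r + i) / ((r : ℝ) + 1 + 2 * i) ^ l) := by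
  rw [tbarTrunc_snoc, sum_Icc_shift, Finset.mul_sum]
  · refine Finset.sum_congr rfl fun i _ => ?_
    rw [Nat.add_sub_cancel, add_right_comm, pow_add, mul_assoc]
    congr 4
    push_cast; ring
  · intro n _ hn
    rw [tuplesSum_eq_zero k (by omega), mul_zero, zero_div, mul_zero]

lemma isSymbol_tuplesSum {r : ℕ} (k : Fin r → ℕ) (hk : ∀ i, 1 ≤ k i) :
    IsSymbol 0 fun j => tuplesSum k (r + j) := by
  induction r with
  | zero => simpa only [tuplesSum_zero] using .const 1
  | succ r ih =>
    rw [← Fin.snoc_init_self k, forall_snoc_iff (P := fun x => 1 ≤ x)] at hk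
    rw [← Fin.snoc_init_self k]
    simp only [tuplesSum_snoc_shift]
    exact (((ih _ hk.1).const_mul 2).div_shifted_pow r hk.2).sum_range_succ

lemma exists_tendsto_tbarTrunc {r : ℕ} (hr : 0 < r) (k : Fin r → ℕ) (hk : ∀ i, 1 ≤ k i) :
    ∃ L : ℝ, Tendsto (tbarTrunc k) atTop (𝓝 L) := by
  obtain ⟨r, rfl⟩ := Nat.exists_eq_succ_of_ne_zero hr.ne'
  rw [← Fin.snoc_init_self k, forall_snoc_iff (P := fun x => 1 ≤ x)] at hk
  obtain ⟨L, hL⟩ := (((isSymbol_tuplesSum _ hk.1).const_mul 2).div_shifted_pow r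
    hk.2).exists_tendsto_alternating (by norm_num)
  refine ⟨(-1) ^ (r + 1) * L, (tendsto_add_atTop_iff_nat r).1 ?_⟩
  refine (hL.const_mul _).congr fun N => ?_
  rw [add_comm N r, ← tbarTrunc_snoc_shift, Fin.snoc_init_self]

/-! ### Sums over all indices of given weight and depth -/

lemma mem_indexSet {k r : ℕ} {a : Fin r → ℕ} :
    a ∈ indexSet k r ↔ (∀ i, 1 ≤ a i) ∧ ∑ i, a i = k := by
  simp only [indexSet, Finset.mem_filter, Fintype.mem_piFinset, Finset.mem_Icc]
  refine ⟨fun h => ⟨fun i => (h.1 i).1, h.2⟩, fun h => ⟨fun i => ⟨h.1 i, ?_⟩, h.2⟩⟩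
  rw [← h.2]
  exact Finset.single_le_sum (fun j _ => Nat.zero_le (a j)) (Finset.mem_univ i)

lemma indexSet_zero (k : ℕ) : indexSet k 0 = if k = 0 then {Fin.elim0} else ∅ := by
  ext a
  split_ifs with hk <;> simp [mem_indexSet, Subsingleton.elim a Fin.elim0, eq_comm, hk]

lemma snoc_mem_indexSet {r d l : ℕ} {b : Fin r → ℕ} :
    (Fin.snoc b l : Fin (r + 1) → ℕ) ∈ indexSet (r + 1 + d) (r + 1) ↔
      l ∈ Finset.Icc 1 (d + 1) ∧ b ∈ indexSet (r + 1 + d - l) r := by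
  simp only [mem_indexSet, forall_snoc_iff (P := fun x => 1 ≤ x), Fin.sum_univ_castSucc,
    Fin.snoc_castSucc, Fin.snoc_last, Finset.mem_Icc]
  constructor
  · rintro ⟨⟨hb, hl⟩, hsum⟩
    have hle : r ≤ ∑ i, b i := by
      simpa using Finset.sum_le_sum fun i (_ : i ∈ Finset.univ) => hb i
    exact ⟨⟨hl, by omega⟩, hb, by omega⟩
  · rintro ⟨hl, hb, hsum⟩
    exact ⟨⟨hb, hl.1⟩, by omega⟩

lemma sum_indexSet_succ {M : Type*} [AddCommMonoid M] (r d : ℕ) (f : (Fin (r + 1) → ℕ) → M) :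
    ∑ k ∈ indexSet (r + 1 + d) (r + 1), f k
      = ∑ e ∈ Finset.range (d + 1), ∑ k ∈ indexSet (r + (d - e)) r, f (Fin.snoc k (e + 1)) := by
  rw [sum_eq_sum_snoc fun _ _ => snoc_mem_indexSet, sum_Icc_eq_sum_range]
  refine Finset.sum_congr rfl fun e he => ?_
  rw [Finset.mem_range] at he
  rw [show r + 1 + d - (e + 1) = r + (d - e) by omega]

lemma sum_tuplesSum (r d j : ℕ) :
    ∑ k ∈ indexSet (r + d) r, tuplesSum k (r + j) = chainSum r d j := by
  induction r generalizing d j with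
  | zero =>
    rw [chainSum_zero, indexSet_zero, zero_add]
    split_ifs <;> simp [tuplesSum_zero]
  | succ r ih =>
    rw [sum_indexSet_succ, chainSum]
    simp only [tuplesSum_snoc_shift, chainCoeff_succ, ← ih, Finset.mul_sum, Finset.sum_div]
    rw [Finset.sum_comm (s := Finset.range (j + 1))]
    exact Finset.sum_congr rfl fun e _ => Finset.sum_comm

lemma sum_tbarTrunc (r d j : ℕ) :
    ∑ k ∈ indexSet (r + 1 + d) (r + 1), tbarTrunc k (r + j)
      = (-1) ^ (r + 1) * ∑ i ∈ Finset.range j, (-1 : ℝ) ^ i * chainCoeff (r + 1) d i := by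
  rw [sum_indexSet_succ]
  simp only [tbarTrunc_snoc_shift, chainCoeff_succ, ← sum_tuplesSum, Finset.mul_sum,
    Finset.sum_div]
  rw [Finset.sum_comm (s := Finset.range j)]
  exact Finset.sum_congr rfl fun e _ => Finset.sum_comm

lemma tendsto_sum_chainCoeff (r d : ℕ) :
    Tendsto (fun N => ∑ i ∈ Finset.range N, (-1 : ℝ) ^ i * chainCoeff (r + 1) d i) atTop
      (𝓝 ((-1) ^ (r + 1) * W (r + 1 + d) (r + 1))) := by
  have hW : Tendsto (fun N => ∑ k ∈ indexSet (r + 1 + d) (r + 1), tbarTrunc k N) atTop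
      (𝓝 (W (r + 1 + d) (r + 1))) :=
    tendsto_finsetSum _ fun k hk =>
      tendsto_nhds_limUnder (exists_tendsto_tbarTrunc r.succ_pos k (mem_indexSet.1 hk).1)
  refine (((tendsto_add_atTop_iff_nat r).2 hW).const_mul _).congr fun N => ?_
  rw [add_comm N r, sum_tbarTrunc, ← mul_assoc, ← mul_pow, neg_one_mul, neg_neg, one_pow, one_mul]

/-! ### Multiple `T`-harmonic sums -/

lemma mem_tTuples {r n : ℕ} {a : Fin r → ℕ} :
    a ∈ tTuples r n ↔ (∀ i, 1 ≤ a i) ∧ ∀ i : Fin r,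
      if Even (i : ℕ) then
        (Fin.snoc a n : Fin (r + 1) → ℕ) i.castSucc ≤ (Fin.snoc a n : Fin (r + 1) → ℕ) i.succ
      else
        (Fin.snoc a n : Fin (r + 1) → ℕ) i.castSucc < (Fin.snoc a n : Fin (r + 1) → ℕ) i.succ := by
  simp only [tTuples, Finset.mem_filter, Fintype.mem_piFinset, Finset.mem_Icc]
  refine ⟨fun h => ⟨fun i => (h.1 i).1, h.2⟩, fun h => ⟨fun i => ⟨h.1 i, ?_⟩, h.2⟩⟩
  have hmono : Monotone (Fin.snoc a n : Fin (r + 1) → ℕ) :=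
    Fin.monotone_iff_le_succ.2 fun i => by
      have := h.2 i
      split_ifs at this
      exacts [this, this.le]
  simpa using hmono (Fin.castSucc_lt_last i).le

lemma tTuples_zero (n : ℕ) : tTuples 0 n = {Fin.elim0} := by
  ext a
  simp [mem_tTuples, Subsingleton.elim a Fin.elim0]

lemma snoc_mem_tTuples {r n l : ℕ} {b : Fin r → ℕ} :
    (Fin.snoc b l : Fin (r + 1) → ℕ) ∈ tTuples (r + 1) n ↔
      l ∈ Finset.Icc 1 (n - r % 2) ∧ b ∈ tTuples r l := by
  have hlast : l ∈ Finset.Icc 1 (n - r % 2) ↔ 1 ≤ l ∧ if Even r then l ≤ n else l < n := by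
    rw [Finset.mem_Icc]
    split_ifs with hr <;> rw [Nat.even_iff] at hr <;> omega
  rw [hlast, mem_tTuples, mem_tTuples, forall_snoc_iff (P := fun x => 1 ≤ x),
    Fin.forall_fin_succ']
  simp only [Fin.snoc_castSucc, Fin.succ_castSucc, Fin.val_castSucc, Fin.snoc_last, Fin.succ_last,
    Fin.val_last]
  tauto

lemma tHarm_ones_zero (n : ℕ) : tHarm (ones 0) n = 1 := by
  simp [tHarm, tTuples_zero]

lemma tHarm_ones_succ (r n : ℕ) :
    tHarm (ones (r + 1)) n = ∑ l ∈ Finset.Icc 1 (n - r % 2),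
      2 * tHarm (ones r) l / (2 * (l : ℝ) - 1 + (r % 2 : ℕ)) := by
  rw [tHarm, sum_eq_sum_snoc fun _ _ => snoc_mem_tTuples]
  refine Finset.sum_congr rfl fun l _ => ?_
  have hden : (if Even r then 2 * (l : ℝ) - 1 else 2 * (l : ℝ)) = 2 * l - 1 + (r % 2 : ℕ) := by
    split_ifs with hr
    · simp [Nat.even_iff.1 hr]
    · simp [Nat.not_even_iff.1 hr]
  rw [tHarm, Finset.mul_sum, Finset.sum_div]
  refine Finset.sum_congr rfl fun b _ => ?_
  simp only [Fin.prod_univ_castSucc, Fin.snoc_castSucc, Fin.snoc_last, Fin.val_castSucc,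
    Fin.val_last, ones, pow_one, hden]
  rw [pow_succ, mul_div_assoc', div_div, mul_comm (2 ^ r : ℝ)]

lemma tHarm_ones_eq_zero (r : ℕ) {n : ℕ} (hn : 1 ≤ n) (hnr : n ≤ r / 2) :
    tHarm (ones r) n = 0 := by
  induction r generalizing n with
  | zero => omega
  | succ r ih =>
    rw [tHarm_ones_succ]
    refine Finset.sum_eq_zero fun l hl => ?_
    rw [Finset.mem_Icc] at hl
    rw [ih hl.1 (by omega), mul_zero, zero_div]

lemma tHarm_ones_shift (r j : ℕ) : tHarm (ones r) (r / 2 + j + 1) = chainSum r 0 j := by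
  induction r generalizing j with
  | zero => rw [chainSum_zero, if_pos rfl, tHarm_ones_zero]
  | succ r ih =>
    rw [tHarm_ones_succ, show (r + 1) / 2 + j + 1 - r % 2 = r / 2 + (j + 1) by omega,
      sum_Icc_shift, chainSum]
    · refine Finset.sum_congr rfl fun i _ => ?_
      rw [ih, chainCoeff_succ_zero]
      congr 1
      have hr : (r : ℝ) = 2 * (r / 2 : ℕ) + (r % 2 : ℕ) := mod_cast (Nat.div_add_mod r 2).symm
      push_cast [hr]
      ring
    · exact fun n hn hnr => by rw [tHarm_ones_eq_zero r hn hnr, mul_zero, zero_div]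

/-! ### The recursion for `Z` -/

lemma mem_chains {j p k : ℕ} {i : Fin (k + 1) → ℕ} :
    i ∈ chains j p k ↔ StrictMono i ∧ i 0 = j ∧ i (Fin.last k) = p := by
  rw [chains, Finset.mem_filter, Fintype.mem_piFinset]
  refine ⟨fun h => h.2, fun h => ⟨fun l => Finset.mem_Icc.2 ⟨?_, ?_⟩, h⟩⟩
  · exact h.2.1 ▸ h.1.monotone (Fin.zero_le l)
  · exact h.2.2 ▸ h.1.monotone (Fin.le_last l)

lemma chains_zero (j p : ℕ) : chains j p 0 = if j = p then {fun _ => j} else ∅ := by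
  ext i
  have hi : i = (fun _ => j) ↔ i 0 = j := by simp [funext_iff, Fin.forall_fin_one]
  rw [mem_chains, and_iff_right (Subsingleton.strictMono (α := Fin 1) i)]
  split_ifs with h
  · rw [Finset.mem_singleton, hi, Fin.last_zero, h, and_self]
  · simp only [Fin.last_zero, Finset.notMem_empty, iff_false]
    exact fun hp => h (hp.1.symm.trans hp.2)

lemma snoc_mem_chains {j p k n : ℕ} {b : Fin (k + 1) → ℕ} :
    (Fin.snoc b n : Fin (k + 2) → ℕ) ∈ chains j p (k + 1) ↔
      n ∈ ({p} : Finset ℕ) ∧ b ∈ (Finset.Ico j p).biUnion fun q => chains j q k := by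
  simp only [mem_chains, strictMono_snoc_iff, Fin.snoc_last, ← Fin.castSucc_zero,
    Fin.snoc_castSucc, Finset.mem_singleton, Finset.mem_biUnion, Finset.mem_Ico]
  constructor
  · rintro ⟨⟨hb, hlt⟩, rfl, rfl⟩
    exact ⟨rfl, _, ⟨hb.monotone (Fin.zero_le _), hlt _⟩, hb, rfl, rfl⟩
  · rintro ⟨rfl, _, ⟨-, hlt⟩, hb, rfl, rfl⟩
    exact ⟨⟨hb, fun i => (hb.monotone (Fin.le_last i)).trans_lt hlt⟩, rfl, rfl⟩

lemma chains_eq_empty {j p k : ℕ} (h : p < j + k) : chains j p k = ∅ := by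
  refine Finset.eq_empty_of_forall_notMem fun i hi => ?_
  rw [mem_chains] at hi
  have hle : ∀ l, i 0 + l ≤ i l := fun l => by
    induction l using Fin.induction with
    | zero => simp
    | succ l ih => exact (Nat.succ_le_succ ih).trans (hi.1 l.castSucc_lt_succ)
  have hlast := hle (Fin.last k)
  rw [Fin.val_last, hi.2.1, hi.2.2] at hlast
  omega

/-- The sum over the chains `j = i₀ < ⋯ < i_k = p` of `∏ -2 ζ̄(2 i_l - 2 i_{l-1})`, that is, the
contribution of the chains of length `k` to `Z(j, p)`. -/
def chainWeight (j p k : ℕ) : ℝ :=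
  ∑ i ∈ chains j p k, ∏ l : Fin k, -2 * zetaBar (2 * i l.succ - 2 * i l.castSucc)

lemma chainWeight_zero (j p : ℕ) : chainWeight j p 0 = if j = p then 1 else 0 := by
  rw [chainWeight, chains_zero]
  split_ifs <;> simp

lemma chainWeight_succ (j p k : ℕ) :
    chainWeight j p (k + 1)
      = ∑ q ∈ Finset.Ico j p, chainWeight j q k * (-2 * zetaBar (2 * p - 2 * q)) := by
  have hdisj : Set.PairwiseDisjoint (Finset.Ico j p) fun q => chains j q k := by
    refine fun q _ q' _ hqq' => Finset.disjoint_left.2 fun b hb hb' => hqq' ?_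
    rw [← (mem_chains.1 hb).2.2, (mem_chains.1 hb').2.2]
  rw [chainWeight, sum_eq_sum_snoc fun _ _ => snoc_mem_chains, Finset.sum_singleton,
    Finset.sum_biUnion hdisj]
  refine Finset.sum_congr rfl fun q _ => ?_
  rw [chainWeight, Finset.sum_mul]
  refine Finset.sum_congr rfl fun b hb => ?_
  simp only [Fin.prod_univ_castSucc, Fin.succ_castSucc, Fin.snoc_castSucc, Fin.succ_last,
    Fin.snoc_last, (mem_chains.1 hb).2.2]

lemma chainWeight_eq_zero {j p k : ℕ} (h : p < j + k) : chainWeight j p k = 0 := by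
  rw [chainWeight, chains_eq_empty h, Finset.sum_empty]

lemma Z_self (p : ℕ) : Z p p = 1 := by simp [Z]

lemma Z_eq_sum_chainWeight {j p M : ℕ} (hM : p < j + M) :
    Z j p = ∑ k ∈ Finset.range M, chainWeight j p k := by
  rcases eq_or_ne j p with rfl | hjp
  · rw [Z_self, Finset.sum_eq_single 0 (fun k _ hk => chainWeight_eq_zero (by omega))
      fun h => absurd (Finset.mem_range.2 (by omega)) h, chainWeight_zero, if_pos rfl]
  · have hsupp : ∑ k ∈ Finset.Icc 1 (p - j), chainWeight j p k
        = ∑ k ∈ Finset.range M, chainWeight j p k := by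
      refine Finset.sum_subset (fun k hk => ?_) fun k _ hk => ?_
      · rw [Finset.mem_Icc] at hk
        exact Finset.mem_range.2 (by omega)
      · rcases k.eq_zero_or_pos with rfl | hk0
        · rw [chainWeight_zero, if_neg hjp]
        · rw [Finset.mem_Icc] at hk
          exact chainWeight_eq_zero (by omega)
    rw [Z, if_neg hjp, ← hsupp]
    refine Finset.sum_congr rfl fun k _ => ?_
    simp only [chainWeight, Finset.mul_sum, Finset.prod_mul_distrib, Finset.prod_const,
      Finset.card_univ, Fintype.card_fin]

lemma Z_of_lt {j p : ℕ} (h : j < p) :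
    Z j p = ∑ q ∈ Finset.Ico j p, Z j q * (-2 * zetaBar (2 * p - 2 * q)) := by
  rw [Z_eq_sum_chainWeight (M := p - j + 1) (by omega), Finset.sum_range_succ', chainWeight_zero,
    if_neg h.ne, add_zero]
  simp only [chainWeight_succ]
  rw [Finset.sum_comm]
  refine Finset.sum_congr rfl fun q hq => ?_
  rw [Finset.mem_Ico] at hq
  rw [Z_eq_sum_chainWeight (M := p - j) (by omega), Finset.sum_mul]

/-- Convolution with `Z` inverts convolution with the sequence `1, 2 ζ̄(2), 2 ζ̄(4), …`. -/
lemma eq_sum_mul_Z {X Y : ℕ → ℝ}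
    (h : ∀ j, 1 ≤ j → Y j = X j + ∑ q ∈ Finset.Ico 1 j, 2 * zetaBar (2 * j - 2 * q) * X q)
    {j : ℕ} (hj : 1 ≤ j) : X j = ∑ i ∈ Finset.Icc 1 j, Y i * Z i j := by
  induction j using Nat.strong_induction_on with
  | _ j ih =>
  have hX : X j = Y j + ∑ q ∈ Finset.Ico 1 j, X q * (-2 * zetaBar (2 * j - 2 * q)) := by
    rw [h j hj, add_assoc, ← Finset.sum_add_distrib, Finset.sum_eq_zero fun q _ => by ring,
      add_zero]
  rw [← Finset.Ico_insert_right hj, Finset.sum_insert (by simp), Z_self, mul_one, hX]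
  congr 1
  calc ∑ q ∈ Finset.Ico 1 j, X q * (-2 * zetaBar (2 * j - 2 * q))
      = ∑ q ∈ Finset.Ico 1 j, ∑ i ∈ Finset.Icc 1 q,
          Y i * (Z i q * (-2 * zetaBar (2 * j - 2 * q))) := by
        refine Finset.sum_congr rfl fun q hq => ?_
        rw [Finset.mem_Ico] at hq
        simp only [ih q hq.2 hq.1, Finset.sum_mul, mul_assoc]
    _ = ∑ i ∈ Finset.Ico 1 j, ∑ q ∈ Finset.Ico i j,
          Y i * (Z i q * (-2 * zetaBar (2 * j - 2 * q))) := by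
        refine Finset.sum_comm' fun q i => ?_
        simp only [Finset.mem_Ico, Finset.mem_Icc]
        omega
    _ = ∑ i ∈ Finset.Ico 1 j, Y i * Z i j := by
        refine Finset.sum_congr rfl fun i hi => ?_
        rw [Z_of_lt (Finset.mem_Ico.1 hi).2, Finset.mul_sum]

/-! ### Alternating power series -/

/-- Sequences of at most polynomial growth; their power series converge on the open unit disc. -/
def PolyBounded (u : ℕ → ℝ) : Prop :=
  ∃ (C : ℝ) (k : ℕ), ∀ n : ℕ, |u n| ≤ C * ((n : ℝ) + 1) ^ k

/-- The alternating generating function `∑ (-1) ^ n u n z ^ n`. -/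
def altSeries (u : ℕ → ℝ) (z : ℝ) : ℝ := ∑' n, (-1) ^ n * u n * z ^ n

lemma IsSymbol.polyBounded {s : ℝ} {u : ℕ → ℝ} (hu : IsSymbol s u) : PolyBounded u := by
  obtain ⟨C, hC, hle⟩ := hu.exists_forall_le one_pos
  refine ⟨C, ⌈s + 1⌉₊, fun n => (hle n).trans ?_⟩
  rw [← Real.rpow_natCast]
  gcongr
  · linarith [n.cast_nonneg (α := ℝ)]
  · exact Nat.le_ceil _

lemma tendsto_altSeries_one {u : ℕ → ℝ} {L : ℝ}
    (hL : Tendsto (fun N => ∑ n ∈ Finset.range N, (-1 : ℝ) ^ n * u n) atTop (𝓝 L)) :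
    Tendsto (altSeries u) (𝓝[<] 1) (𝓝 L) :=
  Real.tendsto_tsum_powerSeries_nhdsWithin_lt hL

lemma altSeries_eq_mul_of_eq_zero {u : ℕ → ℝ} {a : ℕ} (hu : ∀ n < a, u n = 0) (z : ℝ) :
    altSeries u z = (-z) ^ a * altSeries (fun n => u (n + a)) z := by
  rw [altSeries, ← (add_left_injective a).tsum_eq, altSeries, ← tsum_mul_left]
  · refine tsum_congr fun n => ?_
    rw [pow_add, pow_add, neg_pow z]
    ring
  · intro n hn
    refine ⟨n - a, Nat.sub_add_cancel (le_of_not_gt fun h => hn ?_)⟩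
    simp [hu n h]

lemma altSeries_const_mul (c : ℝ) (u : ℕ → ℝ) (z : ℝ) :
    altSeries (fun n => c * u n) z = c * altSeries u z := by
  rw [altSeries, altSeries, ← tsum_mul_left]
  exact tsum_congr fun n => by ring

lemma abs_sq_lt_one {x : ℝ} (hx : |x| < 1) : |x ^ 2| < 1 := by
  rw [abs_pow]
  exact pow_lt_one₀ (abs_nonneg x) hx two_ne_zero

namespace PolyBounded

variable {u v : ℕ → ℝ} {z : ℝ}

lemma add_one_mul (hu : PolyBounded u) : PolyBounded fun n => ((n : ℝ) + 1) * u n := by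
  obtain ⟨C, k, hle⟩ := hu
  refine ⟨C, k + 1, fun n => ?_⟩
  rw [abs_mul, abs_of_nonneg (by positivity), pow_succ, ← mul_assoc, mul_comm _ |u n|]
  exact mul_le_mul_of_nonneg_right (hle n) (by positivity)

lemma mono (hv : PolyBounded v) (h : ∀ n, |u n| ≤ |v n|) : PolyBounded u := by
  obtain ⟨C, k, hle⟩ := hv
  exact ⟨C, k, fun n => (h n).trans (hle n)⟩

lemma nat_mul (hu : PolyBounded u) : PolyBounded fun n => (n : ℝ) * u n :=
  hu.add_one_mul.mono fun n => by
    rw [abs_mul, abs_mul]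
    gcongr
    linarith

lemma succ (hu : PolyBounded u) : PolyBounded fun n => u (n + 1) := by
  obtain ⟨C, k, hle⟩ := hu
  have hC : 0 ≤ C := by simpa using (abs_nonneg _).trans (hle 0)
  refine ⟨C * 2 ^ k, k, fun n => (hle _).trans ?_⟩
  rw [mul_assoc, ← mul_pow]
  gcongr
  push_cast
  linarith

lemma summable_abs (hu : PolyBounded u) (hz : |z| < 1) : Summable fun n => |u n * z ^ n| := by
  obtain ⟨C, k, hle⟩ := hu
  have hO : u =O[atTop] fun n => (n : ℝ) ^ k := by
    refine .of_bound (C * 2 ^ k) ((eventually_ge_atTop 1).mono fun n hn => (hle n).trans ?_)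
    have hn' : (1 : ℝ) ≤ n := mod_cast hn
    have hC : 0 ≤ C := by simpa using (abs_nonneg _).trans (hle 0)
    rw [Real.norm_of_nonneg (by positivity), mul_assoc, ← mul_pow]
    gcongr
    linarith
  have hsum : Summable fun n : ℕ => (n : ℝ) ^ k * |z| ^ n :=
    summable_pow_mul_geometric_of_norm_lt_one k (by rwa [norm_abs_eq_norm])
  refine (summable_of_isBigO_nat hsum (hO.mul ?_)).abs
  exact .of_norm_le fun n => by rw [norm_pow, Real.norm_eq_abs]

lemma hasSum (hu : PolyBounded u) (hz : |z| < 1) :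
    HasSum (fun n => (-1) ^ n * u n * z ^ n) (altSeries u z) :=
  Summable.hasSum <| .of_abs <| (hu.summable_abs hz).congr fun n => by simp [abs_mul]

lemma hasDerivAt (hu : PolyBounded u) (hz : |z| < 1) :
    HasDerivAt (altSeries u) (-altSeries (fun n => (n + 1 : ℕ) * u (n + 1)) z) z := by
  obtain ⟨ρ, hzρ, hρ⟩ := exists_between hz
  have hρ0 : 0 ≤ ρ := (abs_nonneg z).trans hzρ.le
  have hbound : Summable fun n : ℕ => |n * u n| * ρ ^ (n - 1) := by
    rw [← summable_nat_add_iff 1]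
    simpa [abs_mul, abs_of_nonneg hρ0] using
      hu.nat_mul.succ.summable_abs ((abs_of_nonneg hρ0).trans_lt hρ)
  have hle (n : ℕ) (w : ℝ) (hw : w ∈ Set.Ioo (-ρ) ρ) :
      ‖(-1) ^ n * u n * (n * w ^ (n - 1))‖ ≤ |n * u n| * ρ ^ (n - 1) := by
    rw [← mul_assoc, mul_assoc _ (u n), mul_comm (u n), norm_mul, norm_mul, norm_pow, norm_pow,
      norm_neg, norm_one, one_pow, one_mul]
    exact mul_le_mul_of_nonneg_left (pow_le_pow_left₀ (norm_nonneg w) (abs_lt.2 hw).le _)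
      (norm_nonneg _)
  have hmem : z ∈ Set.Ioo (-ρ) ρ := abs_lt.1 hzρ
  refine (hasDerivAt_tsum_of_isPreconnected hbound isOpen_Ioo isPreconnected_Ioo
    (fun n w _ => (hasDerivAt_pow n w).const_mul _) hle hmem (hu.hasSum hz).summable
    hmem).congr_deriv ?_
  rw [(Summable.of_norm_bounded hbound fun n => hle n z hmem).tsum_eq_zero_add, altSeries,
    ← tsum_neg, Nat.cast_zero, zero_mul, mul_zero, zero_add]
  refine tsum_congr fun n => ?_
  rw [Nat.add_sub_cancel]
  ring

lemma const_mul (c : ℝ) (hu : PolyBounded u) : PolyBounded fun n => c * u n := by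
  obtain ⟨C, k, hle⟩ := hu
  refine ⟨|c| * C, k, fun n => ?_⟩
  rw [abs_mul, mul_assoc]
  exact mul_le_mul_of_nonneg_left (hle n) (abs_nonneg c)

lemma altSeries_add (hu : PolyBounded u) (hv : PolyBounded v) (hz : |z| < 1) :
    altSeries (fun n => u n + v n) z = altSeries u z + altSeries v z := by
  rw [← ((hu.hasSum hz).add (hv.hasSum hz)).tsum_eq, altSeries]
  exact tsum_congr fun n => by ring

lemma one_add_mul_altSeries_sum (hu : PolyBounded fun n => ∑ i ∈ Finset.range n, u i)
    (hz : |z| < 1) :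
    (1 + z) * altSeries (fun n => ∑ i ∈ Finset.range (n + 1), u i) z = altSeries u z := by
  have hshift := altSeries_eq_mul_of_eq_zero (u := fun n => ∑ i ∈ Finset.range n, u i) (a := 1)
    (by simp) z
  have hdiff : u = fun n => ∑ i ∈ Finset.range (n + 1), u i + -1 * ∑ i ∈ Finset.range n, u i := by
    funext n
    rw [Finset.sum_range_succ]
    ring
  conv_rhs => rw [hdiff, hu.succ.altSeries_add (hu.const_mul (-1)) hz, altSeries_const_mul, hshift]
  ring

lemma hasDerivAt_mul_altSeries (hu : PolyBounded u) (hz : |z| < 1) :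
    HasDerivAt (fun w => w * altSeries u w) (altSeries (fun n => ((n : ℝ) + 1) * u n) z) z := by
  have euler := altSeries_eq_mul_of_eq_zero (u := fun n => (n : ℝ) * u n) (a := 1) (by simp) z
  simp only [add_mul, one_mul, hu.nat_mul.altSeries_add hu hz, euler]
  refine ((hasDerivAt_id z).mul (hu.hasDerivAt hz)).congr_deriv ?_
  simp only [id]
  ring

/-- Up to the factor `u ^ r`, differentiation of `u ^ (r + 1) f (u ^ 2)` multiplies the `n`-th
coefficient by the exponent `r + 1 + 2 n`. -/
lemma hasDerivAt_pow_mul_altSeries_sq (hu : PolyBounded u) (r : ℕ) (hz : |z| < 1) :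
    HasDerivAt (fun w => w ^ (r + 1) * altSeries u (w ^ 2))
      (z ^ r * altSeries (fun n => ((r : ℝ) + 1 + 2 * n) * u n) (z ^ 2)) z := by
  have hz2 := abs_sq_lt_one hz
  have hcomp : HasDerivAt (fun w : ℝ => altSeries u (w ^ 2)) _ z :=
    HasDerivAt.comp (h := fun w : ℝ => w ^ 2) z (hu.hasDerivAt hz2) (hasDerivAt_pow 2 z)
  refine ((hasDerivAt_pow (r + 1) z).mul hcomp).congr_deriv ?_
  have euler := altSeries_eq_mul_of_eq_zero (u := fun n => (n : ℝ) * u n) (a := 1) (by simp)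
    (z ^ 2)
  have hsplit : altSeries (fun n => ((r : ℝ) + 1 + 2 * n) * u n) (z ^ 2)
      = (r + 1) * altSeries u (z ^ 2) + 2 * altSeries (fun n => (n : ℝ) * u n) (z ^ 2) := by
    rw [← altSeries_const_mul, ← altSeries_const_mul,
      ← (hu.const_mul _).altSeries_add (hu.nat_mul.const_mul _) hz2]
    congr 1
    funext n
    ring
  rw [hsplit, euler]
  push_cast
  ring

end PolyBounded

/-! ### Generating functions of chains -/

/-- The generating function `∑ (-1) ^ i chainCoeff r d i u ^ (r + 2 i)`, a multiple polylogarithm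
that integrates the logarithmic forms `du / u` and `2 du / (1 + u ^ 2)`. -/
def chainGen (r d : ℕ) (u : ℝ) : ℝ := u ^ r * altSeries (chainCoeff r d) (u ^ 2)

lemma chainGen_zero_left (d : ℕ) (u : ℝ) : chainGen 0 d u = if d = 0 then 1 else 0 := by
  rw [chainGen, pow_zero, one_mul, altSeries,
    tsum_eq_single 0 fun i hi => by simp [chainCoeff_zero, hi]]
  simp [chainCoeff_zero]

lemma pow_mul_altSeries_chainSum (r d : ℕ) {u : ℝ} (hu : |u| < 1) :
    u ^ r * altSeries (fun i => 2 * chainSum r d i) (u ^ 2) = 2 / (1 + u ^ 2) * chainGen r d u := by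
  have hsum : (1 + u ^ 2) * altSeries (chainSum r d) (u ^ 2) = altSeries (chainCoeff r d) (u ^ 2) :=
    (isSymbol_chainCoeff r d).sum_range.polyBounded.one_add_mul_altSeries_sum (abs_sq_lt_one hu)
  rw [chainGen, ← hsum, altSeries_const_mul]
  field_simp

lemma hasDerivAt_chainGen_zero (r : ℕ) {u : ℝ} (hu : |u| < 1) :
    HasDerivAt (chainGen (r + 1) 0) (2 / (1 + u ^ 2) * chainGen r 0 u) u := by
  refine ((isSymbol_chainCoeff (r + 1) 0).polyBounded.hasDerivAt_pow_mul_altSeries_sq r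
    hu).congr_deriv ?_
  rw [← pow_mul_altSeries_chainSum r 0 hu]
  congr with i
  rw [chainCoeff_succ_zero, mul_div_cancel₀ _ (by positivity)]

lemma hasDerivAt_chainGen_succ (r d : ℕ) {u : ℝ} (hu : |u| < 1) (h0 : u ≠ 0) :
    HasDerivAt (chainGen (r + 1) (d + 1))
      (2 / (1 + u ^ 2) * chainGen r (d + 1) u + u⁻¹ * chainGen (r + 1) d u) u := by
  refine ((isSymbol_chainCoeff (r + 1) (d + 1)).polyBounded.hasDerivAt_pow_mul_altSeries_sq r
    hu).congr_deriv ?_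
  have hcoeff : (fun i : ℕ => ((r : ℝ) + 1 + 2 * i) * chainCoeff (r + 1) (d + 1) i)
      = fun i => 2 * chainSum r (d + 1) i + chainCoeff (r + 1) d i := by
    funext i
    rw [chainCoeff_succ_succ, mul_div_cancel₀ _ (by positivity)]
  rw [hcoeff, ((isSymbol_chainSum r (d + 1)).polyBounded.const_mul 2).altSeries_add
    (isSymbol_chainCoeff (r + 1) d).polyBounded (abs_sq_lt_one hu), mul_add,
    pow_mul_altSeries_chainSum r (d + 1) hu, chainGen.eq_def (r + 1), pow_succ]
  field_simp
  ring

lemma tendsto_chainGen_one {r d : ℕ} {L : ℝ}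
    (hL : Tendsto (fun N => ∑ i ∈ Finset.range N, (-1 : ℝ) ^ i * chainCoeff r d i) atTop (𝓝 L)) :
    Tendsto (chainGen r d) (𝓝[<] 1) (𝓝 L) := by
  have hsq : Tendsto (fun u : ℝ => u ^ 2) (𝓝[<] 1) (𝓝[<] 1) := by
    refine tendsto_nhdsWithin_iff.2 ⟨?_, ?_⟩
    · simpa using ((continuous_pow 2).tendsto (1 : ℝ)).mono_left nhdsWithin_le_nhds
    · filter_upwards [Ioo_mem_nhdsLT (zero_lt_one' ℝ)] with u hu
      exact pow_lt_one₀ hu.1.le hu.2 two_ne_zero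
  have hpow : Tendsto (fun u : ℝ => u ^ r) (𝓝[<] 1) (𝓝 1) := by
    simpa using ((continuous_pow r).tendsto (1 : ℝ)).mono_left nhdsWithin_le_nhds
  exact (one_mul L) ▸ hpow.mul ((tendsto_altSeries_one hL).comp hsq)

/-! ### Divided powers -/

/-- The divided power `x ^ n / n!`. -/
def divPow (x : ℝ) (n : ℕ) : ℝ := x ^ n / n !

lemma divPow_zero (x : ℝ) : divPow x 0 = 1 := by simp [divPow]

lemma zero_divPow {n : ℕ} (hn : n ≠ 0) : divPow 0 n = 0 := by simp [divPow, hn]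

lemma divPow_nonneg {x : ℝ} (hx : 0 ≤ x) (n : ℕ) : 0 ≤ divPow x n := by
  rw [divPow]
  positivity

lemma continuous_divPow (n : ℕ) : Continuous fun x => divPow x n := by
  unfold divPow
  fun_prop

lemma hasDerivAt_divPow_succ {B : ℝ → ℝ} {b t : ℝ} (hB : HasDerivAt B b t) (n : ℕ) :
    HasDerivAt (fun t => divPow (B t) (n + 1)) (b * divPow (B t) n) t := by
  refine ((hB.pow (n + 1)).div_const _).congr_deriv ?_
  rw [Nat.factorial_succ, Nat.add_sub_cancel, divPow]
  push_cast
  field_simp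

/-- The convolution of `f` with the divided powers of `B`. If `B' = b` and `f' (n + 1) = -b f n`, it
is an antiderivative of `f' 0` times a divided power of `B`. -/
def divSum (B : ℝ → ℝ) (f : ℕ → ℝ → ℝ) (n : ℕ) (t : ℝ) : ℝ :=
  ∑ j ∈ Finset.range (n + 1), divPow (B t) j * f (n - j) t

lemma hasDerivAt_divSum {B : ℝ → ℝ} {f g : ℕ → ℝ → ℝ} {b t : ℝ} (hB : HasDerivAt B b t)
    (hzero : HasDerivAt (f 0) (g 0 t) t)
    (hsucc : ∀ n, HasDerivAt (f (n + 1)) (-b * f n t + g (n + 1) t) t) (n : ℕ) :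
    HasDerivAt (divSum B f n) (divSum B g n t) t := by
  -- The terms in which `B` is differentiated cancel the terms `-b * f n t` telescopically.
  let E (j : ℕ) : ℝ := if j = 0 ∨ n < j then 0 else b * divPow (B t) (j - 1) * f (n - j) t
  have hterm (j : ℕ) (hj : j ∈ Finset.range (n + 1)) :
      HasDerivAt (fun t => divPow (B t) j * f (n - j) t)
        (E j - E (j + 1) + divPow (B t) j * g (n - j) t) t := by
    have hpow : HasDerivAt (fun t => divPow (B t) j)
        (if j = 0 then 0 else b * divPow (B t) (j - 1)) t := by
      cases j with
      | zero => simpa only [divPow_zero, if_pos] using hasDerivAt_const t (1 : ℝ)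
      | succ j => exact hasDerivAt_divPow_succ hB j
    have hf : HasDerivAt (f (n - j))
        ((if n - j = 0 then 0 else -b * f (n - j - 1) t) + g (n - j) t) t := by
      cases n - j with
      | zero => simpa only [if_pos, zero_add] using hzero
      | succ i => exact hsucc i
    refine (hpow.mul hf).congr_deriv ?_
    rw [Finset.mem_range] at hj
    simp only [E, Nat.add_sub_cancel, Nat.sub_sub, show ¬n < j by omega,
      show n < j + 1 ↔ n - j = 0 by omega, or_false, j.succ_ne_zero, false_or]
    split_ifs <;> ring
  have hfirst : E 0 = 0 := if_pos (.inl rfl)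
  have hlast : E (n + 1) = 0 := if_pos (.inr n.lt_succ_self)
  refine (HasDerivAt.fun_sum hterm).congr_deriv ?_
  rw [Finset.sum_add_distrib, Finset.sum_range_sub', hfirst, hlast, sub_self, zero_add, divSum]

lemma hasDerivAt_divSum_of_succ {B : ℝ → ℝ} {f : ℕ → ℝ → ℝ} {a b t : ℝ}
    (hB : HasDerivAt B b t) (hzero : HasDerivAt (f 0) a t)
    (hsucc : ∀ n, HasDerivAt (f (n + 1)) (-b * f n t) t) (n : ℕ) :
    HasDerivAt (divSum B f n) (divPow (B t) n * a) t := by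
  refine (hasDerivAt_divSum (g := fun n _ => if n = 0 then a else 0) hB hzero
    (fun n => (hsucc n).congr_deriv (add_zero _).symm) n).congr_deriv ?_
  rw [divSum, Finset.sum_range_succ, Nat.sub_self, if_pos rfl, Finset.sum_eq_zero, zero_add]
  intro j hj
  rw [if_neg (Nat.sub_ne_zero_of_lt (Finset.mem_range.1 hj)), mul_zero]

lemma tendsto_divSum {B : ℝ → ℝ} {f : ℕ → ℝ → ℝ} {ℓ : ℕ → ℝ} {l : Filter ℝ}
    (hB : Tendsto B l (𝓝 0)) (hf : ∀ n, Tendsto (f n) l (𝓝 (ℓ n))) (n : ℕ) :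
    Tendsto (divSum B f n) l (𝓝 (ℓ n)) := by
  have hlim : Tendsto (divSum B f n) l
      (𝓝 (∑ j ∈ Finset.range (n + 1), divPow 0 j * ℓ (n - j))) :=
    tendsto_finsetSum _ fun j _ => ((continuous_divPow j).tendsto' 0 _ rfl |>.comp hB).mul (hf _)
  rwa [Finset.sum_range_succ', Finset.sum_eq_zero fun j _ => by
    rw [zero_divPow j.succ_ne_zero, zero_mul], zero_add, divPow_zero, one_mul, Nat.sub_zero] at hlim

lemma tendsto_divSum_zero {B : ℝ → ℝ} {f : ℕ → ℝ → ℝ} {l : Filter ℝ}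
    (hf : ∀ i n, Tendsto (fun t => B t ^ i * f n t) l (𝓝 0)) (n : ℕ) :
    Tendsto (divSum B f n) l (𝓝 0) := by
  rw [← Finset.sum_const_zero (s := Finset.range (n + 1))]
  refine tendsto_finsetSum _ fun j _ => ?_
  simpa only [divPow, div_mul_eq_mul_div, zero_div] using (hf j (n - j)).div_const (j ! : ℝ)

lemma hasDerivAt_two_arctan (t : ℝ) :
    HasDerivAt (fun t => 2 * Real.arctan t) (2 / (1 + t ^ 2)) t :=
  ((Real.hasDerivAt_arctan t).const_mul 2).congr_deriv (by ring)

lemma chainGen_eq_divPow_arctan (r : ℕ) {u : ℝ} (hu : |u| < 1) :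
    chainGen r 0 u = divPow (2 * Real.arctan u) r := by
  induction r generalizing u with
  | zero => rw [chainGen_zero_left, if_pos rfl, divPow_zero]
  | succ r ih =>
    have hderiv (v : ℝ) (hv : v ∈ Set.Ioo (-1 : ℝ) 1) :
        HasDerivAt (fun v => chainGen (r + 1) 0 v - divPow (2 * Real.arctan v) (r + 1)) 0 v := by
      refine ((hasDerivAt_chainGen_zero r (abs_lt.2 hv)).sub
        (hasDerivAt_divPow_succ (hasDerivAt_two_arctan v) r)).congr_deriv ?_
      rw [ih (abs_lt.2 hv), sub_self]
    have hconst := isOpen_Ioo.is_const_of_deriv_eq_zero isPreconnected_Ioo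
      (fun v hv => (hderiv v hv).differentiableAt.differentiableWithinAt)
      (fun v hv => (hderiv v hv).deriv) (abs_lt.1 hu) (by norm_num : (0 : ℝ) ∈ Set.Ioo (-1) 1)
    refine sub_eq_zero.1 (hconst.trans ?_)
    rw [Real.arctan_zero, mul_zero, zero_divPow r.succ_ne_zero, chainGen, pow_succ, mul_zero,
      zero_mul, sub_zero]

/-! ### The substitution `s = (1 - t) / (1 + t)` -/

/-- The involution `t ↦ (1 - t) / (1 + t)` of `(0, 1)`, which exchanges the forms `dt / t` and
`2 dt / (1 - t ^ 2)` and preserves `2 dt / (1 + t ^ 2)`, all up to sign. -/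
def cayley (t : ℝ) : ℝ := (1 - t) / (1 + t)

/-- The primitive `log ((1 + t) / (1 - t))` of `2 / (1 - t ^ 2)`. -/
def logRatio (t : ℝ) : ℝ := -Real.log (cayley t)

lemma cayley_mem_Ioo {t : ℝ} (ht : t ∈ Set.Ioo (0 : ℝ) 1) : cayley t ∈ Set.Ioo (0 : ℝ) 1 := by
  have hpos : 0 < 1 + t := by linarith [ht.1]
  exact ⟨div_pos (by linarith [ht.2]) hpos, (div_lt_one hpos).2 (by linarith [ht.1])⟩

lemma abs_cayley_lt_one {t : ℝ} (ht : t ∈ Set.Ioo (0 : ℝ) 1) : |cayley t| < 1 :=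
  (abs_of_pos (cayley_mem_Ioo ht).1).trans_lt (cayley_mem_Ioo ht).2

lemma logRatio_nonneg {t : ℝ} (ht : t ∈ Set.Ioo (0 : ℝ) 1) : 0 ≤ logRatio t :=
  neg_nonneg.2 (Real.log_nonpos (cayley_mem_Ioo ht).1.le (cayley_mem_Ioo ht).2.le)

lemma measurable_logRatio : Measurable logRatio := by
  unfold logRatio cayley
  fun_prop

lemma hasDerivAt_cayley {t : ℝ} (ht : t ∈ Set.Ioo (0 : ℝ) 1) :
    HasDerivAt cayley (-2 / (1 + t) ^ 2) t := by
  have hne : 1 + t ≠ 0 := by linarith [ht.1]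
  refine (((hasDerivAt_id t).const_sub 1).div ((hasDerivAt_id t).const_add 1) hne).congr_deriv ?_
  simp only [id]
  ring

lemma inv_cayley_mul {t : ℝ} (ht : t ∈ Set.Ioo (0 : ℝ) 1) :
    (cayley t)⁻¹ * (-2 / (1 + t) ^ 2) = -(2 / (1 - t ^ 2)) := by
  have hadd : 1 + t ≠ 0 := by linarith [ht.1]
  have hsub : 1 - t ≠ 0 := by linarith [ht.2]
  rw [cayley, show 1 - t ^ 2 = (1 + t) * (1 - t) by ring]
  field_simp

lemma two_div_one_add_cayley_sq_mul {t : ℝ} (ht : t ∈ Set.Ioo (0 : ℝ) 1) :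
    2 / (1 + cayley t ^ 2) * (-2 / (1 + t) ^ 2) = -(2 / (1 + t ^ 2)) := by
  have hadd : 1 + t ≠ 0 := by linarith [ht.1]
  have hsq : (1 + t) ^ 2 + (1 - t) ^ 2 ≠ 0 := by positivity
  rw [cayley, div_pow]
  field_simp
  ring

lemma hasDerivAt_logRatio {t : ℝ} (ht : t ∈ Set.Ioo (0 : ℝ) 1) :
    HasDerivAt logRatio (2 / (1 - t ^ 2)) t := by
  refine ((hasDerivAt_cayley ht).log (cayley_mem_Ioo ht).1.ne').neg.congr_deriv ?_
  rw [div_eq_inv_mul, inv_cayley_mul ht, neg_neg]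

lemma tendsto_cayley_zero : Tendsto cayley (𝓝[>] 0) (𝓝[<] 1) := by
  refine tendsto_nhdsWithin_iff.2 ⟨?_, ?_⟩
  · have hcont : ContinuousAt cayley 0 := by
      unfold cayley
      fun_prop (disch := norm_num)
    simpa [cayley] using hcont.tendsto.mono_left nhdsWithin_le_nhds
  · filter_upwards [Ioo_mem_nhdsGT (zero_lt_one' ℝ)] with t ht using (cayley_mem_Ioo ht).2

lemma tendsto_cayley_one : Tendsto cayley (𝓝[<] 1) (𝓝[>] 0) := by
  refine tendsto_nhdsWithin_iff.2 ⟨?_, ?_⟩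
  · have hcont : ContinuousAt cayley 1 := by
      unfold cayley
      fun_prop (disch := norm_num)
    simpa [cayley] using hcont.tendsto.mono_left nhdsWithin_le_nhds
  · filter_upwards [Ioo_mem_nhdsLT (zero_lt_one' ℝ)] with t ht using (cayley_mem_Ioo ht).1

lemma tendsto_logRatio_zero : Tendsto logRatio (𝓝[>] 0) (𝓝 0) := by
  have hlog : Tendsto (fun s : ℝ => -Real.log s) (𝓝 1) (𝓝 0) :=
    (Real.continuousAt_log one_ne_zero).neg.tendsto.trans (by simp)
  exact hlog.comp (tendsto_cayley_zero.mono_right nhdsWithin_le_nhds)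

lemma tendsto_logRatio_one : Tendsto logRatio (𝓝[<] 1) atTop :=
  tendsto_neg_atBot_atTop.comp (Real.tendsto_log_nhdsGT_zero.comp tendsto_cayley_one)

lemma tendsto_logRatio_pow_mul_cayley (n : ℕ) :
    Tendsto (fun t => logRatio t ^ n * cayley t) (𝓝[<] 1) (𝓝 0) := by
  refine ((Real.tendsto_pow_mul_exp_neg_atTop_nhds_zero n).comp tendsto_logRatio_one).congr' ?_
  filter_upwards [Ioo_mem_nhdsLT (zero_lt_one' ℝ)] with t ht
  rw [Function.comp_apply, logRatio, neg_neg, Real.exp_log (cayley_mem_Ioo ht).1]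

lemma tendsto_logRatio_pow_mul_comp_cayley {f : ℝ → ℝ} (hf : ContinuousAt f 0) (n : ℕ) :
    Tendsto (fun t => logRatio t ^ n * (cayley t * f (cayley t))) (𝓝[<] 1) (𝓝 0) := by
  have hcomp := hf.tendsto.comp (tendsto_cayley_one.mono_right nhdsWithin_le_nhds)
  simpa only [zero_mul, mul_assoc, Function.comp_apply] using
    (tendsto_logRatio_pow_mul_cayley n).mul hcomp

/-! ### Integrability on the unit interval -/

lemma ae_mem_Ioo_of_uIoc {P : ℝ → Prop} (h : ∀ t ∈ Set.Ioo (0 : ℝ) 1, P t) :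
    ∀ᵐ t, t ∈ Set.uIoc (0 : ℝ) 1 → P t := by
  filter_upwards [Measure.ae_ne volume 1] with t ht htm
  rw [Set.uIoc_of_le zero_le_one] at htm
  exact h t ⟨htm.1, lt_of_le_of_ne htm.2 ht⟩

lemma intervalIntegrable_of_abs_le {f g : ℝ → ℝ} (hf : Measurable f)
    (hg : IntervalIntegrable g volume 0 1) (h : ∀ t ∈ Set.Ioo (0 : ℝ) 1, |f t| ≤ g t) :
    IntervalIntegrable f volume 0 1 :=
  hg.mono_fun' hf.aestronglyMeasurable <|
    (ae_restrict_iff' measurableSet_uIoc).2 (ae_mem_Ioo_of_uIoc h)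

lemma divPow_logRatio_le (n : ℕ) {t : ℝ} (ht : t ∈ Set.Ioo (0 : ℝ) 1) :
    divPow (logRatio t) n ≤ 2 ^ n * ((1 - t) ^ (-(1 / 2) : ℝ) / 2 ^ (-(1 / 2) : ℝ)) := by
  have hle : (1 - t) / 2 ≤ cayley t :=
    div_le_div_of_nonneg_left (by linarith [ht.2]) (by linarith [ht.1]) (by linarith [ht.2])
  calc divPow (logRatio t) n = 2 ^ n * ((logRatio t / 2) ^ n / n !) := by
        rw [divPow, div_pow]
        field_simp
    _ ≤ 2 ^ n * Real.exp (logRatio t / 2) := by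
        have := logRatio_nonneg ht
        gcongr
        exact Real.pow_div_factorial_le_exp _ (by positivity) n
    _ = 2 ^ n * cayley t ^ (-(1 / 2) : ℝ) := by
        rw [Real.rpow_def_of_pos (cayley_mem_Ioo ht).1, logRatio]
        ring_nf
    _ ≤ 2 ^ n * ((1 - t) / 2) ^ (-(1 / 2) : ℝ) := by
        gcongr 2 ^ n * ?_
        exact Real.rpow_le_rpow_of_nonpos (by linarith [ht.2]) hle (by norm_num)
    _ = _ := by rw [Real.div_rpow (by linarith [ht.2]) zero_le_two]

lemma intervalIntegrable_divPow_logRatio (n : ℕ) :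
    IntervalIntegrable (fun t => divPow (logRatio t) n) volume 0 1 := by
  have hrpow : IntervalIntegrable (fun t : ℝ => (1 - t) ^ (-(1 / 2) : ℝ)) volume 0 1 := by
    simpa using (intervalIntegral.intervalIntegrable_rpow' (a := 1) (b := 0) (r := -(1 / 2))
      (by norm_num)).comp_sub_left 1
  refine intervalIntegrable_of_abs_le ((continuous_divPow n).measurable.comp measurable_logRatio)
    ((hrpow.div_const (2 ^ (-(1 / 2) : ℝ))).const_mul (2 ^ n)) fun t ht => ?_
  rw [abs_of_nonneg (divPow_nonneg (logRatio_nonneg ht) n)]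
  exact divPow_logRatio_le n ht

/-! ### Iterated integrals -/

/-- The density `(2 arctan t) ^ r / r! * 2 / (1 + t ^ 2)`, that is, the derivative of a divided
power of `2 arctan t`. -/
def arctanKernel (r : ℕ) (t : ℝ) : ℝ := divPow (2 * Real.arctan t) r * (2 / (1 + t ^ 2))

lemma continuous_arctanKernel (r : ℕ) : Continuous (arctanKernel r) := by
  have hden (t : ℝ) : 1 + t ^ 2 ≠ 0 := by positivity
  exact ((continuous_divPow r).comp (continuous_const.mul Real.continuous_arctan)).mul
    (by fun_prop (disch := exact hden _))

/-- The convolution over `d` of `chainGen r d`, at the transformed variable `cayley t`, with the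
divided powers of `logRatio t`. -/
def cayleyChain (r d : ℕ) : ℝ → ℝ := divSum logRatio (fun i t => chainGen r i (cayley t)) d

lemma cayleyChain_zero_left (d : ℕ) (t : ℝ) : cayleyChain 0 d t = divPow (logRatio t) d := by
  rw [cayleyChain, divSum, Finset.sum_range_succ, Nat.sub_self, chainGen_zero_left, if_pos rfl,
    mul_one, Finset.sum_eq_zero, zero_add]
  intro j hj
  rw [chainGen_zero_left, if_neg (Nat.sub_ne_zero_of_lt (Finset.mem_range.1 hj)), mul_zero]

lemma hasDerivAt_cayleyChain_succ (r d : ℕ) {t : ℝ} (ht : t ∈ Set.Ioo (0 : ℝ) 1) :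
    HasDerivAt (cayleyChain (r + 1) d) (-(2 / (1 + t ^ 2)) * cayleyChain r d t) t := by
  have hcayley := hasDerivAt_cayley ht
  have hlt := abs_cayley_lt_one ht
  have hne := (cayley_mem_Ioo ht).1.ne'
  refine (hasDerivAt_divSum (g := fun i t => -(2 / (1 + t ^ 2)) * chainGen r i (cayley t))
    (hasDerivAt_logRatio ht) ?_ (fun i => ?_) d).congr_deriv ?_
  · refine ((hasDerivAt_chainGen_zero r hlt).comp t hcayley).congr_deriv ?_
    rw [← two_div_one_add_cayley_sq_mul ht]
    ring
  · refine ((hasDerivAt_chainGen_succ r i hlt hne).comp t hcayley).congr_deriv ?_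
    rw [← two_div_one_add_cayley_sq_mul ht, ← inv_cayley_mul ht]
    ring
  · simp only [cayleyChain, divSum, Finset.mul_sum, mul_left_comm]

lemma tendsto_cayleyChain_zero (r d : ℕ) :
    Tendsto (cayleyChain (r + 1) d) (𝓝[>] 0) (𝓝 ((-1) ^ (r + 1) * W (r + 1 + d) (r + 1))) :=
  tendsto_divSum tendsto_logRatio_zero
    (fun i => (tendsto_chainGen_one (tendsto_sum_chainCoeff r i)).comp tendsto_cayley_zero) d

lemma tendsto_cayleyChain_one (r d : ℕ) :
    Tendsto (cayleyChain (r + 1) d) (𝓝[<] 1) (𝓝 0) := by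
  refine tendsto_divSum_zero (fun n i => ?_) d
  have hcont : ContinuousAt (fun u : ℝ => u ^ r * altSeries (chainCoeff (r + 1) i) (u ^ 2)) 0 := by
    refine (continuousAt_id.pow r).mul (ContinuousAt.comp' ?_ (continuousAt_id.pow 2))
    exact ((isSymbol_chainCoeff (r + 1) i).polyBounded.hasDerivAt (by simp)).continuousAt
  refine (tendsto_logRatio_pow_mul_comp_cayley hcont n).congr fun t => ?_
  rw [chainGen, pow_succ' _ r, mul_assoc]

lemma hasDerivAt_divSum_cayleyChain (r d : ℕ) {t : ℝ} (ht : t ∈ Set.Ioo (0 : ℝ) 1) :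
    HasDerivAt (divSum (fun t => 2 * Real.arctan t) (fun i => cayleyChain (i + 1) d) r)
      (-(arctanKernel r t * divPow (logRatio t) d)) t := by
  refine (hasDerivAt_divSum_of_succ (hasDerivAt_two_arctan t)
    (hasDerivAt_cayleyChain_succ 0 d ht)
    (fun i => hasDerivAt_cayleyChain_succ (i + 1) d ht) r).congr_deriv ?_
  rw [cayleyChain_zero_left, arctanKernel]
  ring

lemma integral_arctanKernel_mul_divPow_logRatio (r d : ℕ) :
    ∫ t in (0 : ℝ)..1, arctanKernel r t * divPow (logRatio t) d
      = (-1) ^ (r + 1) * W (r + 1 + d) (r + 1) := by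
  have hint := (intervalIntegrable_divPow_logRatio d).continuousOn_mul
    (continuous_arctanKernel r).continuousOn
  have hcont : Continuous fun t => 2 * Real.arctan t := by fun_prop
  have hzero : Tendsto (fun t => 2 * Real.arctan t) (𝓝[>] 0) (𝓝 0) :=
    (hcont.tendsto' 0 0 (by simp)).mono_left nhdsWithin_le_nhds
  have hone : Tendsto (divSum (fun t => 2 * Real.arctan t) (fun i => cayleyChain (i + 1) d) r)
      (𝓝[<] 1) (𝓝 0) := by
    refine tendsto_divSum_zero (fun n i => ?_) r
    simpa only [mul_zero] using (((hcont.tendsto 1).mono_left nhdsWithin_le_nhds).pow n).mul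
      (tendsto_cayleyChain_one i d)
  have hftc := intervalIntegral.integral_eq_sub_of_hasDerivAt_of_tendsto zero_lt_one
    (fun t ht => hasDerivAt_divSum_cayleyChain r d ht) hint.neg
    (tendsto_divSum hzero (fun i => tendsto_cayleyChain_zero i d) r) hone
  rwa [intervalIntegral.integral_neg, zero_sub, neg_inj] at hftc

/-! ### Alternating zeta values as integrals -/

lemma zetaBarTrunc_eq_sum_range (k N : ℕ) :
    zetaBarTrunc k N = ∑ n ∈ Finset.range N, (-1 : ℝ) ^ n * (((n : ℝ) + 1) ^ k)⁻¹ := by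
  rw [zetaBarTrunc, sum_Icc_eq_sum_range]
  refine Finset.sum_congr rfl fun n _ => ?_
  rw [Nat.add_sub_cancel, div_eq_mul_inv]
  push_cast
  rfl

lemma isSymbol_inv_succ_pow {k : ℕ} (hk : 1 ≤ k) :
    IsSymbol (-1) fun n => (((n : ℝ) + 1) ^ k)⁻¹ := by
  simpa only [one_mul] using IsSymbol.inv_linear_pow one_pos one_pos hk

lemma exists_tendsto_zetaBarTrunc {k : ℕ} (hk : 1 ≤ k) :
    ∃ L : ℝ, Tendsto (zetaBarTrunc k) atTop (𝓝 L) := by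
  simpa only [← zetaBarTrunc_eq_sum_range] using
    (isSymbol_inv_succ_pow hk).exists_tendsto_alternating neg_one_lt_zero

lemma tendsto_zetaBarTrunc {k : ℕ} (hk : 1 ≤ k) :
    Tendsto (zetaBarTrunc k) atTop (𝓝 (zetaBar k)) := by
  rw [zetaBar, if_neg (by omega)]
  exact tendsto_nhds_limUnder (exists_tendsto_zetaBarTrunc hk)

/-- The Dirichlet eta polylogarithm `-Li_k(-z) = ∑ (-1) ^ (n - 1) z ^ n / n ^ k`. -/
def etaPolylog (k : ℕ) (z : ℝ) : ℝ := z * altSeries (fun n => (((n : ℝ) + 1) ^ k)⁻¹) z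

lemma polyBounded_inv_succ_pow (k : ℕ) : PolyBounded fun n => (((n : ℝ) + 1) ^ k)⁻¹ := by
  refine ⟨1, 0, fun n => ?_⟩
  rw [abs_of_nonneg (by positivity), pow_zero, mul_one]
  exact inv_le_one_of_one_le₀ (one_le_pow₀ (by linarith [n.cast_nonneg (α := ℝ)]))

lemma etaPolylog_zero {z : ℝ} (hz : |z| < 1) : etaPolylog 0 z = z / (1 + z) := by
  have hgeom : altSeries (fun _ => 1) z = (1 + z)⁻¹ := by
    rw [← sub_neg_eq_add, ← tsum_geometric_of_abs_lt_one (by rwa [abs_neg]), altSeries]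
    exact tsum_congr fun n => by rw [mul_one, neg_pow z]
  simp only [etaPolylog, pow_zero, inv_one, hgeom, div_eq_mul_inv]

lemma hasDerivAt_etaPolylog_succ (k : ℕ) {z : ℝ} (hz : |z| < 1) (h0 : z ≠ 0) :
    HasDerivAt (etaPolylog (k + 1)) (z⁻¹ * etaPolylog k z) z := by
  refine ((polyBounded_inv_succ_pow (k + 1)).hasDerivAt_mul_altSeries hz).congr_deriv ?_
  rw [etaPolylog, inv_mul_cancel_left₀ h0]
  congr with n
  rw [pow_succ]
  field_simp

lemma etaPolylog_zero_cayley {t : ℝ} (ht : t ∈ Set.Ioo (0 : ℝ) 1) :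
    etaPolylog 0 (cayley t) = (1 - t) / 2 := by
  have hne : 1 + t ≠ 0 := by linarith [ht.1]
  have htwo : 1 + t + (1 - t) ≠ 0 := by ring_nf; norm_num
  rw [etaPolylog_zero (abs_cayley_lt_one ht), cayley]
  field_simp
  ring

lemma hasDerivAt_etaPolylog_zero_cayley {t : ℝ} (ht : t ∈ Set.Ioo (0 : ℝ) 1) :
    HasDerivAt (fun t => etaPolylog 0 (cayley t)) (-1 / 2) t := by
  refine HasDerivAt.congr_of_eventuallyEq
    (((hasDerivAt_id t).const_sub 1).div_const 2 : HasDerivAt (fun t => (1 - t) / 2) _ t) ?_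
  filter_upwards [isOpen_Ioo.mem_nhds ht] with s hs using etaPolylog_zero_cayley hs

lemma hasDerivAt_etaPolylog_succ_cayley (k : ℕ) {t : ℝ} (ht : t ∈ Set.Ioo (0 : ℝ) 1) :
    HasDerivAt (fun t => etaPolylog (k + 1) (cayley t))
      (-(2 / (1 - t ^ 2)) * etaPolylog k (cayley t)) t := by
  refine ((hasDerivAt_etaPolylog_succ k (abs_cayley_lt_one ht) (cayley_mem_Ioo ht).1.ne').comp t
    (hasDerivAt_cayley ht)).congr_deriv ?_
  rw [← inv_cayley_mul ht]
  ring

lemma tendsto_etaPolylog_cayley_zero (k : ℕ) :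
    Tendsto (fun t => etaPolylog k (cayley t)) (𝓝[>] 0) (𝓝 (zetaBar k)) := by
  rcases Nat.eq_zero_or_pos k with rfl | hk
  · have hcont : Continuous fun t : ℝ => (1 - t) / 2 := by fun_prop
    rw [zetaBar, if_pos rfl]
    refine ((hcont.tendsto' 0 (1 / 2) (by norm_num)).mono_left nhdsWithin_le_nhds).congr' ?_
    filter_upwards [Ioo_mem_nhdsGT (zero_lt_one' ℝ)] with t ht
    exact (etaPolylog_zero_cayley ht).symm
  · have hseries := tendsto_altSeries_one <|
      (tendsto_zetaBarTrunc hk).congr fun N => zetaBarTrunc_eq_sum_range k N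
    exact one_mul (zetaBar k) ▸ (tendsto_cayley_zero.mono_right nhdsWithin_le_nhds).mul
      (hseries.comp tendsto_cayley_zero)

lemma integral_divPow_logRatio (n : ℕ) :
    ∫ t in (0 : ℝ)..1, divPow (logRatio t) n = 2 * zetaBar n := by
  have hderiv (t : ℝ) (ht : t ∈ Set.Ioo (0 : ℝ) 1) :=
    hasDerivAt_divSum_of_succ (f := fun k t => etaPolylog k (cayley t))
      (hasDerivAt_logRatio ht) (hasDerivAt_etaPolylog_zero_cayley ht)
      (fun k => hasDerivAt_etaPolylog_succ_cayley k ht) n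
  have hone (i k : ℕ) :
      Tendsto (fun t => logRatio t ^ i * etaPolylog k (cayley t)) (𝓝[<] 1) (𝓝 0) :=
    tendsto_logRatio_pow_mul_comp_cayley
      ((polyBounded_inv_succ_pow k).hasDerivAt (by simp)).continuousAt i
  have hftc := intervalIntegral.integral_eq_sub_of_hasDerivAt_of_tendsto zero_lt_one hderiv
    ((intervalIntegrable_divPow_logRatio n).mul_const _)
    (tendsto_divSum tendsto_logRatio_zero tendsto_etaPolylog_cayley_zero n)
    (tendsto_divSum_zero hone n)
  rw [intervalIntegral.integral_mul_const] at hftc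
  linarith

/-! ### Moments of powers of the logarithm -/

/-- The moment `∫₀¹ t ^ k log ((1 + t) / (1 - t)) ^ d / d! dt`. -/
def logMoment (k d : ℕ) : ℝ := ∫ t in (0 : ℝ)..1, t ^ k * divPow (logRatio t) d

lemma intervalIntegrable_pow_mul_divPow_logRatio (k d : ℕ) :
    IntervalIntegrable (fun t => t ^ k * divPow (logRatio t) d) volume 0 1 :=
  (intervalIntegrable_divPow_logRatio d).continuousOn_mul (continuous_pow k).continuousOn

lemma logMoment_zero_right (k : ℕ) : logMoment k 0 = ((k : ℝ) + 1)⁻¹ := by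
  simp [logMoment, divPow_zero, integral_pow]

lemma logMoment_zero_left (d : ℕ) : logMoment 0 d = 2 * zetaBar d := by
  simp only [logMoment, pow_zero, one_mul, integral_divPow_logRatio]

lemma hasDerivAt_pow_sub_pow_mul_divPow_logRatio (k d : ℕ) {t : ℝ} (ht : t ∈ Set.Ioo (0 : ℝ) 1) :
    HasDerivAt (fun t => (t ^ k - t ^ (k + 2)) * divPow (logRatio t) (d + 1))
      (k * (t ^ (k - 1) * divPow (logRatio t) (d + 1))
        - (k + 2) * (t ^ (k + 1) * divPow (logRatio t) (d + 1))
        + 2 * (t ^ k * divPow (logRatio t) d)) t := by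
  have hne : 1 - t ^ 2 ≠ 0 := by nlinarith [ht.1, ht.2]
  have hcancel : (t ^ k - t ^ (k + 2)) * (2 / (1 - t ^ 2)) = 2 * t ^ k := by
    rw [pow_add, ← mul_one_sub]
    field_simp
  refine (((hasDerivAt_pow k t).sub (hasDerivAt_pow (k + 2) t)).mul
    (hasDerivAt_divPow_succ (hasDerivAt_logRatio ht) d)).congr_deriv ?_
  simp only [Pi.sub_apply]
  rw [← mul_assoc _ (2 / (1 - t ^ 2)), hcancel, show k + 2 - 1 = k + 1 by omega]
  push_cast
  ring

lemma tendsto_pow_sub_pow_mul_divPow_logRatio_one (k d : ℕ) :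
    Tendsto (fun t => (t ^ k - t ^ (k + 2)) * divPow (logRatio t) d) (𝓝[<] 1) (𝓝 0) := by
  have hcont : Continuous fun t : ℝ => t ^ k * (1 + t) ^ 2 / d ! := by fun_prop
  have hlim := (hcont.continuousAt.tendsto.mono_left nhdsWithin_le_nhds).mul
    (tendsto_logRatio_pow_mul_cayley d)
  rw [mul_zero] at hlim
  refine hlim.congr' ?_
  filter_upwards [Ioo_mem_nhdsLT (zero_lt_one' ℝ)] with t ht
  have hne : 1 + t ≠ 0 := by linarith [ht.1]
  rw [divPow, cayley]
  field_simp [hne]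
  ring

lemma mul_logMoment_succ_succ (k d : ℕ) :
    ((k : ℝ) + 2) * logMoment (k + 1) (d + 1)
      = k * logMoment (k - 1) (d + 1) + 2 * logMoment k d := by
  have hint₁ := (intervalIntegrable_pow_mul_divPow_logRatio (k - 1) (d + 1)).const_mul (k : ℝ)
  have hint₂ := (intervalIntegrable_pow_mul_divPow_logRatio (k + 1) (d + 1)).const_mul ((k : ℝ) + 2)
  have hint₃ := (intervalIntegrable_pow_mul_divPow_logRatio k d).const_mul 2
  have hpow : Continuous fun t : ℝ => t ^ k - t ^ (k + 2) := by fun_prop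
  have hzero : Tendsto (fun t => (t ^ k - t ^ (k + 2)) * divPow (logRatio t) (d + 1))
      (𝓝[>] 0) (𝓝 0) := by
    simpa [zero_divPow] using (hpow.continuousAt.tendsto.mono_left nhdsWithin_le_nhds).mul
      (((continuous_divPow (d + 1)).tendsto 0).comp tendsto_logRatio_zero)
  have hftc := intervalIntegral.integral_eq_sub_of_hasDerivAt_of_tendsto zero_lt_one
    (fun t ht => hasDerivAt_pow_sub_pow_mul_divPow_logRatio k d ht)
    ((hint₁.sub hint₂).add hint₃) hzero (tendsto_pow_sub_pow_mul_divPow_logRatio_one k (d + 1))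
  rw [intervalIntegral.integral_add (hint₁.sub hint₂) hint₃,
    intervalIntegral.integral_sub hint₁ hint₂, intervalIntegral.integral_const_mul,
    intervalIntegral.integral_const_mul, intervalIntegral.integral_const_mul] at hftc
  simp only [logMoment]
  linarith

lemma mul_logMoment_succ_eq_sum (d n : ℕ) :
    (2 * (n : ℝ) + 1 + ((d + 1) % 2 : ℕ)) * logMoment (2 * n + (d + 1) % 2) (d + 1)
      = (d % 2 : ℕ) * logMoment 0 (d + 1)
        + ∑ l ∈ Finset.Icc 1 (n + 1 - d % 2), 2 * logMoment (2 * (l - 1) + d % 2) d := by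
  rcases Nat.mod_two_eq_zero_or_one d with hd | hd
  · simp only [hd, show (d + 1) % 2 = 1 by omega, Nat.sub_zero, Nat.cast_zero, zero_mul, zero_add]
    induction n with
    | zero => simpa [one_add_one_eq_two] using mul_logMoment_succ_succ 0 d
    | succ n ih =>
      have hrec := mul_logMoment_succ_succ (2 * (n + 1)) d
      rw [Finset.sum_Icc_succ_top (by omega), ← ih, Nat.add_sub_cancel]
      rw [show 2 * (n + 1) - 1 = 2 * n + 1 by omega] at hrec
      simp only [Nat.cast_add, Nat.cast_mul, Nat.cast_ofNat, Nat.cast_one, add_zero] at hrec ⊢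
      linarith
  · simp only [hd, show (d + 1) % 2 = 0 by omega, Nat.add_sub_cancel, Nat.cast_one, one_mul]
    induction n with
    | zero => simp
    | succ n ih =>
      have hrec := mul_logMoment_succ_succ (2 * n + 1) d
      rw [Finset.sum_Icc_succ_top (by omega), ← add_assoc, ← ih, Nat.add_sub_cancel]
      rw [Nat.add_sub_cancel] at hrec
      rw [show 2 * (n + 1) = 2 * n + 1 + 1 by ring]
      simp only [Nat.cast_add, Nat.cast_mul, Nat.cast_ofNat, Nat.cast_one, Nat.cast_zero,
        add_zero] at hrec ⊢
      linarith

/-- The convolution of the moments `logMoment 0 (2 i)` with the `T`-harmonic sums of depths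
`d - 2 i`. -/
def momentConv (d n : ℕ) : ℝ :=
  ∑ i ∈ Finset.range (d / 2 + 1), logMoment 0 (2 * i) * tHarm (ones (d - 2 * i)) n

lemma momentConv_succ (d n : ℕ) :
    momentConv (d + 1) n = (d % 2 : ℕ) * logMoment 0 (d + 1)
      + ∑ l ∈ Finset.Icc 1 (n - d % 2), 2 * momentConv d l / (2 * (l : ℝ) - 1 + (d % 2 : ℕ)) := by
  have hterm : ∀ i ∈ Finset.range (d / 2 + 1), logMoment 0 (2 * i) * tHarm (ones (d + 1 - 2 * i)) n
      = ∑ l ∈ Finset.Icc 1 (n - d % 2), 2 * (logMoment 0 (2 * i) * tHarm (ones (d - 2 * i)) l)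
        / (2 * (l : ℝ) - 1 + (d % 2 : ℕ)) := fun i hi => by
    have hi := Finset.mem_range.1 hi
    rw [show d + 1 - 2 * i = d - 2 * i + 1 by omega, tHarm_ones_succ,
      show (d - 2 * i) % 2 = d % 2 by omega, Finset.mul_sum]
    exact Finset.sum_congr rfl fun l _ => by ring
  have hconv : ∑ i ∈ Finset.range (d / 2 + 1), logMoment 0 (2 * i) * tHarm (ones (d + 1 - 2 * i)) n
      = ∑ l ∈ Finset.Icc 1 (n - d % 2), 2 * momentConv d l / (2 * (l : ℝ) - 1 + (d % 2 : ℕ)) := by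
    simp only [momentConv, Finset.mul_sum, Finset.sum_div]
    rw [Finset.sum_congr rfl hterm, Finset.sum_comm]
  rw [← hconv, momentConv]
  rcases Nat.mod_two_eq_zero_or_one d with hd | hd
  · rw [hd, Nat.cast_zero, zero_mul, zero_add, show (d + 1) / 2 = d / 2 by omega]
  · rw [hd, Nat.cast_one, one_mul, show (d + 1) / 2 = d / 2 + 1 by omega, Finset.sum_range_succ,
      show 2 * (d / 2 + 1) = d + 1 by omega, Nat.sub_self, tHarm_ones_zero, mul_one, add_comm]

lemma mul_logMoment_eq_momentConv (d n : ℕ) :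
    (2 * (n : ℝ) + 1 + (d % 2 : ℕ)) * logMoment (2 * n + d % 2) d = momentConv d (n + 1) := by
  induction d generalizing n with
  | zero =>
    have hne : 2 * (n : ℝ) + 1 ≠ 0 := by positivity
    simp [momentConv, logMoment_zero_right, tHarm_ones_zero, hne]
  | succ d ih =>
    rw [mul_logMoment_succ_eq_sum, momentConv_succ]
    congr 1
    refine Finset.sum_congr rfl fun l hl => ?_
    obtain ⟨l, rfl⟩ := Nat.exists_eq_add_of_le' (Finset.mem_Icc.1 hl).1
    have hden : 2 * ((l + 1 : ℕ) : ℝ) - 1 + (d % 2 : ℕ) = 2 * l + 1 + (d % 2 : ℕ) := by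
      push_cast
      ring
    rw [hden, ← ih, Nat.add_sub_cancel, mul_left_comm,
      mul_div_cancel_left₀ _ (by positivity)]

lemma logMoment_even_eq_tHarm_add_sum {n j : ℕ} (hn : 1 ≤ n) (hj : 1 ≤ j) :
    logMoment (2 * (n - 1)) (2 * (j - 1))
      = tHarm (ones (2 * j - 2)) n / (2 * (n : ℝ) - 1)
        + ∑ q ∈ Finset.Ico 1 j, 2 * zetaBar (2 * j - 2 * q)
          * (tHarm (ones (2 * q - 2)) n / (2 * (n : ℝ) - 1)) := by
  obtain ⟨n, rfl⟩ := Nat.exists_eq_add_of_le' hn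
  obtain ⟨b, rfl⟩ := Nat.exists_eq_add_of_le' hj
  have hne : 2 * (n : ℝ) + 1 ≠ 0 := by positivity
  have hden : 2 * ((n + 1 : ℕ) : ℝ) - 1 = 2 * n + 1 := by
    push_cast
    ring
  have hconv := mul_logMoment_eq_momentConv (2 * b) n
  rw [Nat.mul_mod_right, Nat.cast_zero, add_zero, add_zero, momentConv, Finset.sum_range_succ',
    Nat.mul_div_cancel_left b two_pos, mul_zero, logMoment_zero_right, Nat.cast_zero, zero_add,
    inv_one, one_mul, Nat.sub_zero] at hconv
  have hreflect : ∑ q ∈ Finset.Ico 1 (b + 1), 2 * zetaBar (2 * (b + 1) - 2 * q)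
        * (tHarm (ones (2 * q - 2)) (n + 1) / (2 * (n : ℝ) + 1))
      = ∑ i ∈ Finset.range b, logMoment 0 (2 * (i + 1))
        * tHarm (ones (2 * b - 2 * (i + 1))) (n + 1) / (2 * (n : ℝ) + 1) := by
    rw [Finset.sum_Ico_eq_sum_range, Nat.add_sub_cancel, ← Finset.sum_range_reflect]
    refine Finset.sum_congr rfl fun i hi => ?_
    have hi := Finset.mem_range.1 hi
    rw [logMoment_zero_left, mul_div_assoc,
      show 2 * (b + 1) - 2 * (1 + (b - 1 - i)) = 2 * (i + 1) by omega,
      show 2 * (1 + (b - 1 - i)) - 2 = 2 * b - 2 * (i + 1) by omega]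
  rw [hden, hreflect, ← Finset.sum_div, ← add_div, eq_div_iff hne, Nat.add_sub_cancel,
    Nat.add_sub_cancel, show 2 * (b + 1) - 2 = 2 * b by omega, mul_comm, hconv, add_comm]

lemma tHarm_div_eq_sum_logMoment_mul_Z {n p : ℕ} (hn : 1 ≤ n) (hp : 1 ≤ p) :
    tHarm (ones (2 * p - 2)) n / (2 * (n : ℝ) - 1)
      = ∑ j ∈ Finset.Icc 1 p, logMoment (2 * (n - 1)) (2 * (j - 1)) * Z j p :=
  eq_sum_mul_Z (X := fun j => tHarm (ones (2 * j - 2)) n / (2 * (n : ℝ) - 1))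
    (fun _ hj => logMoment_even_eq_tHarm_add_sum hn hj) hp

/-! ### The series of two `T`-harmonic sums -/

lemma isSymbol_tHarm_ones (r : ℕ) : IsSymbol 0 fun n => tHarm (ones r) (n + 1) := by
  induction r with
  | zero => simpa only [tHarm_ones_zero] using IsSymbol.const 1
  | succ r ih =>
    have hterm : IsSymbol (-1) fun n =>
        2 * tHarm (ones r) (n + 1) * (2 * (n : ℝ) + (1 + (r % 2 : ℕ)))⁻¹ := by
      simpa only [zero_add] using
        (ih.const_mul 2).mul (IsSymbol.inv_linear two_pos (by positivity))
    have hsum (N : ℕ) : ∑ l ∈ Finset.Icc 1 N, 2 * tHarm (ones r) l / (2 * (l : ℝ) - 1 + (r % 2 : ℕ))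
        = ∑ n ∈ Finset.range N,
          2 * tHarm (ones r) (n + 1) * (2 * (n : ℝ) + (1 + (r % 2 : ℕ)))⁻¹ := by
      rw [sum_Icc_eq_sum_range]
      refine Finset.sum_congr rfl fun n _ => ?_
      rw [div_eq_mul_inv]
      push_cast
      ring
    simp only [tHarm_ones_succ, hsum]
    rcases Nat.mod_two_eq_zero_or_one r with hr | hr
    · simpa only [hr, Nat.sub_zero] using hterm.sum_range_succ
    · simpa only [hr, Nat.add_sub_cancel] using hterm.sum_range

lemma altSeries_tHarm_ones_even (a : ℕ) {u : ℝ} (hu : |u| < 1) :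
    altSeries (fun n => tHarm (ones (2 * a)) (n + 1)) (u ^ 2)
      = (-1) ^ a / 2 * arctanKernel (2 * a) u := by
  have hshift (n : ℕ) : tHarm (ones (2 * a)) (n + a + 1) = chainSum (2 * a) 0 n := by
    rw [← tHarm_ones_shift, Nat.mul_div_cancel_left a two_pos, add_comm a]
  have hchain := pow_mul_altSeries_chainSum (2 * a) 0 hu
  rw [altSeries_const_mul, chainGen_eq_divPow_arctan _ hu] at hchain
  rw [altSeries_eq_mul_of_eq_zero (a := a)
    fun n hn => tHarm_ones_eq_zero (2 * a) n.succ_pos (by omega)]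
  simp only [hshift]
  rw [arctanKernel, mul_comm (divPow _ _), ← hchain, neg_pow, ← pow_mul]
  ring

lemma altSeries_mul_logMoment {u : ℕ → ℝ} (hu : PolyBounded u) (d : ℕ) {ρ : ℝ} (hρ : |ρ| < 1) :
    altSeries (fun n => u n * logMoment (2 * n) d) ρ
      = ∫ t in (0 : ℝ)..1, altSeries u (ρ * t ^ 2) * divPow (logRatio t) d := by
  have hmeas : Measurable fun t => divPow (logRatio t) d :=
    (continuous_divPow d).measurable.comp measurable_logRatio
  have hsum := intervalIntegral.hasSum_integral_of_dominated_convergence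
    (a := 0) (b := 1) (μ := volume)
    (F := fun n t => (-1) ^ n * u n * ρ ^ n * (t ^ (2 * n) * divPow (logRatio t) d))
    (f := fun t => altSeries u (ρ * t ^ 2) * divPow (logRatio t) d)
    (fun n t => |u n * ρ ^ n| * divPow (logRatio t) d)
    (fun n => Measurable.aestronglyMeasurable (by fun_prop)) (fun n => ?_)
    (.of_forall fun t _ => (hu.summable_abs hρ).mul_right _) ?_ ?_
  · rw [← hsum.tsum_eq, altSeries]
    refine tsum_congr fun n => ?_
    rw [intervalIntegral.integral_const_mul, ← logMoment]
    ring
  · refine ae_mem_Ioo_of_uIoc fun t ht => ?_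
    have hpos := divPow_nonneg (logRatio_nonneg ht) d
    have hcoeff : ‖(-1) ^ n * u n * ρ ^ n‖ = |u n * ρ ^ n| := by simp [abs_mul]
    rw [norm_mul, hcoeff, Real.norm_of_nonneg (mul_nonneg (pow_nonneg ht.1.le _) hpos)]
    gcongr
    exact mul_le_of_le_one_left hpos (pow_le_one₀ ht.1.le ht.2.le)
  · simp only [tsum_mul_right]
    exact (intervalIntegrable_divPow_logRatio d).const_mul _
  · refine ae_mem_Ioo_of_uIoc fun t ht => ?_
    have hlt : |ρ * t ^ 2| < 1 := by
      rw [abs_mul, abs_of_nonneg (sq_nonneg t)]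
      exact mul_lt_one_of_nonneg_of_lt_one_left (abs_nonneg ρ) hρ (pow_le_one₀ ht.1.le ht.2.le)
    simpa only [mul_pow, ← pow_mul, mul_assoc] using
      (hu.hasSum hlt).mul_right (divPow (logRatio t) d)

lemma tendsto_integral_sqrt_mul_divPow_logRatio {K : ℝ → ℝ} (hK : Continuous K) (d : ℕ) :
    Tendsto (fun ρ => ∫ t in (0 : ℝ)..1, K (√ρ * t) * divPow (logRatio t) d) (𝓝[<] 1)
      (𝓝 (∫ t in (0 : ℝ)..1, K t * divPow (logRatio t) d)) := by
  obtain ⟨C, hC⟩ := isCompact_Icc.exists_bound_of_continuousOn (s := Set.Icc (0 : ℝ) 1)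
    hK.continuousOn
  have hmeas : Measurable fun t => divPow (logRatio t) d :=
    (continuous_divPow d).measurable.comp measurable_logRatio
  refine intervalIntegral.tendsto_integral_filter_of_dominated_convergence
    (fun t => C * divPow (logRatio t) d)
    (.of_forall fun ρ => Measurable.aestronglyMeasurable ?_) ?_
    ((intervalIntegrable_divPow_logRatio d).const_mul C) (.of_forall fun t _ => ?_)
  · exact (hK.comp (continuous_const_mul √ρ)).measurable.mul hmeas
  · filter_upwards [Ioo_mem_nhdsLT (zero_lt_one' ℝ)] with ρ hρ
    refine ae_mem_Ioo_of_uIoc fun t ht => ?_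
    have hpos := divPow_nonneg (logRatio_nonneg ht) d
    rw [norm_mul, Real.norm_of_nonneg hpos]
    refine mul_le_mul_of_nonneg_right (hC _ ⟨mul_nonneg (Real.sqrt_nonneg ρ) ht.1.le, ?_⟩) hpos
    exact mul_le_one₀ (Real.sqrt_le_one.2 hρ.2.le) ht.1.le ht.2.le
  · have hcont : Continuous fun ρ => K (√ρ * t) := by fun_prop
    exact ((hcont.tendsto' 1 (K t) (by simp)).mono_left nhdsWithin_le_nhds).mul_const _

lemma tendsto_altSeries_mul_logMoment {u : ℕ → ℝ} (hu : PolyBounded u) {K : ℝ → ℝ}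
    (hK : Continuous K) (huK : ∀ x : ℝ, |x| < 1 → altSeries u (x ^ 2) = K x) (d : ℕ) :
    Tendsto (altSeries fun n => u n * logMoment (2 * n) d) (𝓝[<] 1)
      (𝓝 (∫ t in (0 : ℝ)..1, K t * divPow (logRatio t) d)) := by
  refine (tendsto_integral_sqrt_mul_divPow_logRatio hK d).congr' ?_
  filter_upwards [Ioo_mem_nhdsLT (zero_lt_one' ℝ)] with ρ hρ
  rw [altSeries_mul_logMoment hu d (by rw [abs_of_pos hρ.1]; exact hρ.2)]
  refine intervalIntegral.integral_congr_ae (ae_mem_Ioo_of_uIoc fun t ht => ?_)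
  have hsqrt : √ρ < 1 := (Real.sqrt_lt' one_pos).2 (by simpa using hρ.2)
  have hlt : |√ρ * t| < 1 := by
    rw [abs_of_nonneg (mul_nonneg (Real.sqrt_nonneg ρ) ht.1.le)]
    exact mul_lt_one_of_nonneg_of_lt_one_left (Real.sqrt_nonneg ρ) hsqrt ht.2.le
  rw [← huK _ hlt, mul_pow, Real.sq_sqrt hρ.1.le]

lemma isSymbol_logMoment_even (b : ℕ) : IsSymbol (-1) fun n => logMoment (2 * n) (2 * b) := by
  have hconv : IsSymbol 0 fun n => momentConv (2 * b) (n + 1) :=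
    IsSymbol.sum _ fun i _ => (isSymbol_tHarm_ones _).const_mul _
  have hmul := hconv.mul (IsSymbol.inv_linear two_pos one_pos)
  rw [zero_add] at hmul
  convert hmul using 2 with n
  have hne : 2 * (n : ℝ) + 1 ≠ 0 := by positivity
  rw [← mul_logMoment_eq_momentConv, Nat.mul_mod_right, Nat.cast_zero, add_zero, add_zero]
  field_simp

lemma tendsto_sum_tHarm_mul_logMoment (a b : ℕ) :
    Tendsto (fun N => ∑ n ∈ Finset.range N,
      (-1 : ℝ) ^ n * (tHarm (ones (2 * a)) (n + 1) * logMoment (2 * n) (2 * b))) atTop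
      (𝓝 (-((-1) ^ a / 2 * W (2 * a + 1 + 2 * b) (2 * a + 1)))) := by
  have hsymbol := isSymbol_tHarm_ones (2 * a)
  obtain ⟨L, hL⟩ := ((hsymbol.mul (isSymbol_logMoment_even b)).mono
    (zero_add _).le).exists_tendsto_alternating neg_one_lt_zero
  have habel := tendsto_altSeries_mul_logMoment hsymbol.polyBounded
    ((continuous_arctanKernel (2 * a)).const_mul ((-1) ^ a / 2))
    (fun _ hx => altSeries_tHarm_ones_even a hx) (2 * b)
  simp only [mul_assoc, intervalIntegral.integral_const_mul,
    integral_arctanKernel_mul_divPow_logRatio] at habel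
  rw [tendsto_nhds_unique (tendsto_altSeries_one hL) habel, pow_succ, pow_mul, neg_one_sq,
    one_pow] at hL
  simpa only [one_mul, neg_mul, mul_neg] using hL

lemma tendsto_two_mul_sum_tHarm_mul_logMoment {m j : ℕ} (hm : 0 < m) (hj : 1 ≤ j) :
    Tendsto (fun N => 2 * ∑ n ∈ Finset.Icc 1 N,
      tHarm (ones (2 * m - 2)) n * logMoment (2 * (n - 1)) (2 * (j - 1)) * (-1 : ℝ) ^ n) atTop
      (𝓝 ((-1) ^ (m - 1) * W (2 * j + 2 * m - 3) (2 * m - 1))) := by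
  obtain ⟨a, rfl⟩ := Nat.exists_eq_add_of_le' hm
  obtain ⟨b, rfl⟩ := Nat.exists_eq_add_of_le' hj
  rw [show 2 * (b + 1) + 2 * (a + 1) - 3 = 2 * a + 1 + 2 * b by omega,
    show 2 * (a + 1) - 1 = 2 * a + 1 by omega, show 2 * (a + 1) - 2 = 2 * a by omega,
    Nat.add_sub_cancel, Nat.add_sub_cancel]
  convert (tendsto_sum_tHarm_mul_logMoment a b).const_mul (-2) using 2 with N
  · rw [sum_Icc_eq_sum_range, Finset.mul_sum, Finset.mul_sum]
    refine Finset.sum_congr rfl fun n _ => ?_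
    rw [Nat.add_sub_cancel, pow_succ]
    ring
  · ring

lemma two_mul_sum_tHarm_mul_tHarm {p : ℕ} (hp : 0 < p) (m N : ℕ) :
    2 * ∑ n ∈ Finset.Icc 1 N, tHarm (ones (2 * m - 2)) n * tHarm (ones (2 * p - 2)) n
        / (2 * (n : ℝ) - 1) * (-1 : ℝ) ^ n
      = ∑ j ∈ Finset.Icc 1 p, (2 * ∑ n ∈ Finset.Icc 1 N, tHarm (ones (2 * m - 2)) n
        * logMoment (2 * (n - 1)) (2 * (j - 1)) * (-1 : ℝ) ^ n) * Z j p := by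
  simp only [Finset.mul_sum, Finset.sum_mul]
  rw [Finset.sum_comm]
  refine Finset.sum_congr rfl fun n hn => ?_
  rw [mul_div_assoc, tHarm_div_eq_sum_logMoment_mul_Z (Finset.mem_Icc.1 hn).1 hp, Finset.mul_sum,
    Finset.sum_mul, Finset.mul_sum]
  exact Finset.sum_congr rfl fun j _ => by ring

end AltMTV

end

theorem theorem3p3 (m p : ℕ) (hm : 0 < m) (hp : 0 < p) :
    (∀ j ∈ Finset.Icc 1 p, ∀ k ∈ AltMTV.indexSet (2 * j + 2 * m - 3) (2 * m - 1),
      ∃ L : ℝ, Filter.Tendsto (AltMTV.tbarTrunc k) Filter.atTop (nhds L)) ∧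
    (∀ i : ℕ, 0 < i →
      ∃ L : ℝ, Filter.Tendsto (AltMTV.zetaBarTrunc (2 * i)) Filter.atTop (nhds L)) ∧
    Filter.Tendsto
      (fun N : ℕ => 2 * ∑ n ∈ Finset.Icc 1 N,
        AltMTV.tHarm (AltMTV.ones (2 * m - 2)) n * AltMTV.tHarm (AltMTV.ones (2 * p - 2)) n /
          (2 * (n : ℝ) - 1) * (-1 : ℝ) ^ n)
      Filter.atTop
      (nhds ((-1 : ℝ) ^ (m - 1) *
        ∑ j ∈ Finset.Icc 1 p, AltMTV.W (2 * j + 2 * m - 3) (2 * m - 1) * AltMTV.Z j p)) := by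
  refine ⟨fun j _ k hk => AltMTV.exists_tendsto_tbarTrunc (by omega) k (AltMTV.mem_indexSet.1 hk).1,
    fun i hi => AltMTV.exists_tendsto_zetaBarTrunc (by omega), ?_⟩
  simp only [AltMTV.two_mul_sum_tHarm_mul_tHarm hp, Finset.mul_sum, ← mul_assoc]
  refine tendsto_finsetSum _ fun j hj => Filter.Tendsto.mul_const _ ?_
  simpa only [Finset.mul_sum, ← mul_assoc] using
    AltMTV.tendsto_two_mul_sum_tHarm_mul_logMoment hm (Finset.mem_Icc.1 hj).1
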